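/- A chord diagram of size $n$ is a pairing of $2n$ points placed in a fixed (labelled) order on a circle, each pair being joined by a chord. Two chords $\{a<b\}$ and $\{c<d\}$ cross if $a<c<b<d$ or $c<a<d<b$. The intersection graph of a chord diagram has the chords as vertices, with an edge between two chords exactly when they cross; the components of the diagram are the connected components of this graph, and the size of a component is its number of chords. Let $A$ be any real constant with $A>5/\log\frac{225}{224}$, and let $m=m(n)$ be any sequence of nonnegative integers with $m(n)\le n/14$ for all $n$. Let $D_n$ be chosen uniformly at random from all chord diagrams of size $n$ with exactly $m(n)$ crossings. Then \[ \lim_{n\to\infty}\Pr\bigl(\text{the largest component of } D_n \text{ has at most } A\log n \text{ chords}\bigr)=1 . \] In particular, there is an absolute constant $A>0$, independent of the sequence $m(n)$, with this property. -/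

import Mathlib

open Filter Topology ProbabilityTheory

/-- A chord diagram of size `n`: a pairing of the `2 n` points `0 < 1 < ⋯ < 2 n - 1`, placed in
this order on a circle (or on a line). The pairing is given by the map sending each point to
its partner, a fixed-point-free involution. -/
@[ext]
structure ChordDiagram (n : ℕ) where
  partner : Fin (2 * n) → Fin (2 * n)
  partner_partner : ∀ a, partner (partner a) = a
  partner_ne : ∀ a, partner a ≠ a

namespace ChordDiagram

variable {n : ℕ}

instance : Finite (ChordDiagram n) :=
  Finite.of_injective ChordDiagram.partner fun _ _ h => ChordDiagram.ext h

/-- All sets of chord diagrams of size `n` are events. -/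
instance : MeasurableSpace (ChordDiagram n) := ⊤

instance : DiscreteMeasurableSpace (ChordDiagram n) := ⟨fun _ => trivial⟩

/-- The chords of `D`. The chord joining the points `a < b` is represented by its first
endpoint `a`; its other endpoint is `b = D.partner a`. -/
def Chord (D : ChordDiagram n) : Type :=
  {a : Fin (2 * n) // a < D.partner a}

instance (D : ChordDiagram n) : Finite D.Chord :=
  inferInstanceAs (Finite {a : Fin (2 * n) // a < D.partner a})

/-- The first (smaller) endpoint of a chord. -/
def Chord.left {D : ChordDiagram n} (c : D.Chord) : Fin (2 * n) := c.1

/-- The second (larger) endpoint of a chord. -/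
def Chord.right {D : ChordDiagram n} (c : D.Chord) : Fin (2 * n) := D.partner c.1

/-- Two chords cross when their endpoints alternate. -/
def Crosses {D : ChordDiagram n} (c d : D.Chord) : Prop :=
  (c.left < d.left ∧ d.left < c.right ∧ c.right < d.right) ∨
    (d.left < c.left ∧ c.left < d.right ∧ d.right < c.right)

/-- The intersection graph of `D`: its vertices are the chords of `D`, and two chords are
adjacent if and only if they cross. -/
def intersectionGraph (D : ChordDiagram n) : SimpleGraph D.Chord where
  Adj c d := Crosses c d
  symm := ⟨fun _ _ h => Or.symm h⟩
  loopless := ⟨fun c h => by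
    rcases h with h | h <;> exact lt_irrefl _ h.1⟩

/-- The number of crossings of `D`, i.e. the number of (unordered) pairs of crossing chords. -/
noncomputable def numCrossings (D : ChordDiagram n) : ℕ :=
  D.intersectionGraph.edgeSet.ncard

/-- The number of chords in the largest component of `D`, a component being a connected
component of the intersection graph (`0` for the empty diagram). -/
noncomputable def largestComponentSize (D : ChordDiagram n) : ℕ :=
  ⨆ K : D.intersectionGraph.ConnectedComponent, K.supp.ncard

/-- The law of the random chord diagram with `n` chords and `m` crossings: the uniform
distribution on the set of all such diagrams. -/
noncomputable def randomDiagram (n m : ℕ) : MeasureTheory.Measure (ChordDiagram n) :=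
  uniformOn {D : ChordDiagram n | D.numCrossings = m}

end ChordDiagram

/-!
A chord diagram is drawn with `m` crossings exactly when its partner map is a perfect matching of
`2 * n` points with `m` crossings, so everything reduces to weighted counts of matchings.

*Matchings as labelled lattice paths.* Reading the points from left to right, the number of open
chords performs a lattice path, and closing a chord creates one crossing for each chord that was
opened later and is still open. Hence `∑ q ^ crossings` is a sum over lattice paths in which a
down-step from height `h` has weight `1 + q + ⋯ + q ^ (h - 1)` (`sum_pow_card_crossings`). Two
bounds follow.

* Since a down-step has weight at most `1 / (1 - q)`, the weight of the matchings of `2 * k` points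
  is at most `(4 / (1 - q)) ^ k`, and the generating function of all matchings at `(1 - q) / 4` is
  at most `2`, the mean number of visits of a killed random walk to its starting point
  (`sum_pathWeight_mul_pow_le`).
* For `m ≤ n / 14` the height restriction on the labels is nearly harmless, and the number of
  matchings with `m` crossings is at least `catalan n * n.multichoose m / (4 * n)`
  (`catalan_mul_multichoose_le`). With `q = m / (n + m) ≤ 1 / 15` this says that the
  number of matchings with `m` crossings, multiplied by `q ^ m * ((1 - q) / 4) ^ n`, is at least
  a constant times `n ^ (-4)` (`one_le_mul_coeff_pathWeight`).

*Large components.* Let `P` be the set of the endpoints of a component with `k` chords. The rest of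
the diagram splits into independent matchings of the `2 * k` gaps of `P`, since no chord outside the
component can separate its points (`rankIn_partner_mod`). Summing over the positions of `P`, each
gap contributes a factor at most `2`, up to a factor of order `n` for the position of the
first point (`sum_prod_gap_le`). The component itself is connected and has at least
`k - 1` crossings, so its weight at `q` is at most `(2 * q) ^ (k - 1)` times the weight at `1 / 2`
of all matchings of `2 * k` points, i.e. at most `(2 * q) ^ (k - 1) * 8 ^ k`
(`sum_many_crossings_le`). Together with the factor `((1 - q) / 4) ^ k * 4 ^ k` this leaves a
constant times `(16 * q * (1 - q)) ^ (k - 1) ≤ (224 / 225) ^ (k - 1)`.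

Comparing the two sides, a component with more than `K` chords has probability at most a constant
times `n ^ 5 * (224 / 225) ^ K` (`randomDiagram_setOf_lt_le`), which tends to `0` for
`K = ⌊A * log n⌋` as soon as `A * log (225 / 224) > 5`.
-/

namespace ChordDiagram

/-! ### Weighted lattice paths -/

/-- The total weight of the lattice paths with `u` steps `±1` that start at height `h`, end at
height `0` and never go below `0`, where a down-step starting at height `j` has weight
`1 + q + ⋯ + q ^ (j - 1)`. At `q = 0` every path has weight `1`. -/
def pathWeight {R : Type*} [CommSemiring R] (q : R) : ℕ → ℕ → R
  | 0, 0 => 1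
  | 0, _ + 1 => 0
  | u + 1, 0 => pathWeight q u 1
  | u + 1, h + 1 => pathWeight q u (h + 2) + (∑ a ∈ Finset.range (h + 1), q ^ a) * pathWeight q u h

/-! ### Matchings and lattice paths -/

section Matchings

variable {α : Type*} [LinearOrder α]

/-- The restriction of a matching to the chords with endpoints in `S`. -/
def restrict (S : Finset α) (f : α → α) : α → α := fun x => if x ∈ S then f x else x

lemma restrict_of_mem {S : Finset α} {f : α → α} {x : α} (h : x ∈ S) : restrict S f x = f x :=
  if_pos h

lemma restrict_of_notMem {S : Finset α} {f : α → α} {x : α} (h : x ∉ S) : restrict S f x = x :=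
  if_neg h

lemma sum_pow_card_filter_lt {R : Type*} [CommSemiring R] (q : R) (H : Finset α) :
    ∑ x ∈ H, q ^ (H.filter (x < ·)).card = ∑ a ∈ Finset.range H.card, q ^ a := by
  induction H using Finset.induction_on_min with
  | empty => simp
  | insert a s ha ih =>
    have has : a ∉ s := fun h => lt_irrefl _ (ha a h)
    rw [Finset.sum_insert has, Finset.card_insert_of_notMem has, Finset.sum_range_succ, ← ih,
      add_comm]
    congr 1
    · refine Finset.sum_congr rfl fun x hx => ?_
      rw [Finset.filter_insert, if_neg (ha x hx).not_gt]
    · rw [Finset.filter_insert, if_neg (lt_irrefl a), Finset.filter_true_of_mem ha]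

variable [Fintype α]

/-- The perfect matchings of the points of `T`, each given by the map that sends a point of `T`
to its partner and fixes all other points. -/
def matchings (T : Finset α) : Finset (α → α) :=
  {f | (∀ x, f (f x) = x) ∧ ∀ x, f x ≠ x ↔ x ∈ T}

/-- The crossings of a matching: the crossing of two chords is represented by the pair of their
first endpoints, in increasing order. -/
def crossings (f : α → α) : Finset (α × α) :=
  {p | p.1 < p.2 ∧ p.2 < f p.1 ∧ f p.1 < f p.2}

lemma mem_matchings {T : Finset α} {f : α → α} :
    f ∈ matchings T ↔ (∀ x, f (f x) = x) ∧ ∀ x, f x ≠ x ↔ x ∈ T := by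
  simp [matchings]

lemma mem_crossings {f : α → α} {p : α × α} :
    p ∈ crossings f ↔ p.1 < p.2 ∧ p.2 < f p.1 ∧ f p.1 < f p.2 := by
  simp [crossings]

lemma apply_mem_of_mem_matchings {T : Finset α} {f : α → α} (hf : f ∈ matchings T) {x : α}
    (hx : x ∈ T) : f x ∈ T := by
  rw [mem_matchings] at hf
  rw [← hf.2, hf.1]
  exact ((hf.2 x).2 hx).symm

lemma restrict_mem_matchings {T S : Finset α} {f : α → α} (hf : f ∈ matchings T) (hST : S ⊆ T)
    (hS : ∀ x ∈ S, f x ∈ S) : restrict S f ∈ matchings S := by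
  rw [mem_matchings] at hf ⊢
  refine ⟨fun x => ?_, fun x => ?_⟩
  · by_cases hx : x ∈ S
    · rw [restrict_of_mem hx, restrict_of_mem (hS x hx), hf.1]
    · rw [restrict_of_notMem hx, restrict_of_notMem hx]
  · by_cases hx : x ∈ S
    · rw [restrict_of_mem hx]
      exact ⟨fun _ => hx, fun _ => (hf.2 x).2 (hST hx)⟩
    · rw [restrict_of_notMem hx]
      simp [hx]

/-- Removing the chord whose second endpoint `u` comes first removes one crossing for each point
between its endpoints: all of these are first endpoints. -/
lemma card_crossings_eq_add {H U : Finset α} {u x : α} (hHu : ∀ y ∈ H, y < u)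
    (hU : ∀ y ∈ U, u < y) {f : α → α} (hf : f ∈ matchings (H ∪ insert u U))
    (hH : ∀ y ∈ H, y < f y) (hx : x ∈ H) (hfu : f u = x) :
    (crossings f).card = (H.filter (x < ·)).card +
      (crossings (restrict ((H.erase x) ∪ U) f)).card := by
  have hf' := mem_matchings.1 hf
  have hfx : f x = u := by rw [← hfu, hf'.1]
  have huH : u ∉ H := fun h => lt_irrefl _ (hHu u h)
  have huU : u ∉ U := fun h => lt_irrefl _ (hU u h)
  have hxu := hHu x hx
  have hxU : x ∉ U := fun h => lt_asymm hxu (hU x h)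
  have hinj : ∀ y z, f y = f z → y = z := fun y z h => by rw [← hf'.1 y, h, hf'.1]
  have hbig : ∀ y ∈ H, y ≠ x → u < f y := by
    intro y hy hyx
    have h1 : f y ∈ H ∪ insert u U :=
      apply_mem_of_mem_matchings hf (Finset.mem_union_left _ hy)
    rw [Finset.mem_union, Finset.mem_insert] at h1
    rcases h1 with h1 | h1 | h1
    · have h2 := hH _ h1
      rw [hf'.1] at h2
      exact absurd (hH y hy) h2.not_gt
    · exact absurd (hinj y x (by rw [h1, hfx])) hyx
    · exact hU _ h1
  rw [← Finset.card_image_of_injective (H.filter (x < ·)) (Prod.mk_right_injective x),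
    ← Finset.card_union_of_disjoint]
  · congr 1
    ext ⟨a, c⟩
    simp only [mem_crossings, Finset.mem_union, Finset.mem_image, Finset.mem_filter,
      Prod.mk.injEq]
    have key : ∀ z, z ≠ x → z ≠ u → restrict ((H.erase x) ∪ U) f z = f z := by
      intro z hzx hzu
      by_cases hz : z ∈ (H.erase x) ∪ U
      · exact restrict_of_mem hz
      · rw [restrict_of_notMem hz]
        by_contra hne
        have := (hf'.2 z).1 (Ne.symm hne)
        simp only [Finset.mem_union, Finset.mem_insert, Finset.mem_erase] at this hz
        tauto
    have keyx : restrict ((H.erase x) ∪ U) f x = x := restrict_of_notMem (by simp [hxU])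
    have keyu : restrict ((H.erase x) ∪ U) f u = u := restrict_of_notMem (by simp [huH, huU])
    have hlow : ∀ z, z < u → z < f z → z ∈ H := by
      intro z hzu hz
      have := (hf'.2 z).1 hz.ne'
      rw [Finset.mem_union, Finset.mem_insert] at this
      rcases this with h | h | h
      · exact h
      · exact absurd h hzu.ne
      · exact absurd (hU z h) hzu.not_gt
    constructor
    · rintro ⟨h1, h2, h3⟩
      by_cases hax : a = x
      · left
        subst hax
        rw [hfx] at h2 h3
        exact ⟨c, ⟨hlow c h2 (h2.trans h3), h1⟩, rfl, rfl⟩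
      · right
        have hau : a ≠ u := by
          rintro rfl
          rw [hfu] at h2
          exact absurd (h1.trans h2) hxu.not_gt
        have hcx : c ≠ x := by
          rintro rfl
          rw [hfx] at h3
          exact absurd (hbig a (hlow a (h1.trans hxu) (h1.trans h2)) hax) h3.not_gt
        have hcu : c ≠ u := by
          rintro rfl
          rw [hfu] at h3
          exact absurd (h2.trans h3) hxu.not_gt
        rw [key a hax hau, key c hcx hcu]
        exact ⟨h1, h2, h3⟩
    · rintro (⟨y, ⟨hy, hxy⟩, rfl, rfl⟩ | ⟨h1, h2, h3⟩)
      · rw [hfx]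
        exact ⟨hxy, hHu y hy, hbig y hy hxy.ne'⟩
      · have hax : a ≠ x := by
          rintro rfl
          rw [keyx] at h2
          exact lt_asymm h1 h2
        have hau : a ≠ u := by
          rintro rfl
          rw [keyu] at h2
          exact lt_asymm h1 h2
        have hcx : c ≠ x := by
          rintro rfl
          rw [keyx] at h3
          exact lt_asymm h3 h2
        have hcu : c ≠ u := by
          rintro rfl
          rw [keyu] at h3
          exact lt_asymm h3 h2
        rw [key a hax hau] at h2
        rw [key a hax hau, key c hcx hcu] at h3
        exact ⟨h1, h2, h3⟩
  · rw [Finset.disjoint_left]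
    rintro ⟨a, c⟩ h1 h2
    obtain ⟨y, hy, he⟩ := Finset.mem_image.1 h1
    simp only [Prod.mk.injEq] at he
    obtain ⟨rfl, rfl⟩ := he
    rw [mem_crossings] at h2
    have keyx : restrict ((H.erase x) ∪ U) f x = x := restrict_of_notMem (by simp [hxU])
    simp only [keyx] at h2
    exact lt_asymm h2.1 h2.2.1

/-- A matching of `H ∪ U`, with all points of `H` before those of `U` and all of `H` being first
endpoints, is read as a lattice path starting at height `|H|`: the height is the number of chords
that are still open. The second endpoint of a chord is a down-step, and the choice of the chord
that it closes contributes one crossing for each chord opened later and still open. -/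
theorem sum_pow_card_crossings {R : Type*} [CommSemiring R] (q : R) (H U : Finset α)
    (hHU : ∀ x ∈ H, ∀ y ∈ U, x < y) :
    ∑ f ∈ (matchings (H ∪ U)).filter (fun f => ∀ x ∈ H, x < f x), q ^ (crossings f).card =
      pathWeight q U.card H.card := by
  induction U using Finset.induction_on_min generalizing H with
  | empty =>
    rcases H.eq_empty_or_nonempty with rfl | ⟨x, hx⟩
    · have : (matchings (∅ ∪ ∅ : Finset α)).filter (fun f => ∀ x ∈ (∅ : Finset α), x < f x) =
          {id} := by
        ext f
        simp only [Finset.union_empty, Finset.notMem_empty, false_imp_iff, implies_true,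
          Finset.filter_true, mem_matchings, iff_false, not_not, Finset.mem_singleton]
        constructor
        · exact fun h => funext h.2
        · rintro rfl
          simp
      rw [this, Finset.sum_singleton]
      have : crossings (id : α → α) = ∅ := by
        ext p
        simp only [mem_crossings, id, Finset.notMem_empty, iff_false]
        exact fun h => lt_asymm h.1 h.2.1
      simp [this, pathWeight]
    · rw [Finset.filter_false_of_mem, Finset.sum_empty]
      · obtain ⟨k, hk⟩ := Nat.exists_eq_succ_of_ne_zero (Finset.card_ne_zero_of_mem hx)
        rw [hk, Finset.card_empty, pathWeight]
      · intro f hf h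
        rw [Finset.union_empty] at hf
        have h1 := h _ (apply_mem_of_mem_matchings hf hx)
        rw [(mem_matchings.1 hf).1] at h1
        exact lt_asymm h1 (h x hx)
  | insert u U hu ih =>
    have huU : u ∉ U := fun h => lt_irrefl _ (hu u h)
    have hHu : ∀ y ∈ H, y < u := fun y hy => hHU y hy u (Finset.mem_insert_self _ _)
    have huH : u ∉ H := fun h => lt_irrefl _ (hHu u h)
    have hHU' : ∀ x ∈ H, ∀ y ∈ U, x < y := fun x hx y hy =>
      hHU x hx y (Finset.mem_insert_of_mem hy)
    rw [← Finset.sum_filter_add_sum_filter_not _ (fun f => u < f u)]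
    have hopen : ∑ f ∈ ((matchings (H ∪ insert u U)).filter (fun f => ∀ x ∈ H, x < f x)).filter
        (fun f => u < f u), q ^ (crossings f).card = pathWeight q U.card (H.card + 1) := by
      rw [Finset.filter_filter, ← Finset.card_insert_of_notMem huH, ← ih (insert u H)]
      · refine Finset.sum_congr ?_ fun _ _ => rfl
        rw [Finset.insert_union, Finset.union_insert]
        refine Finset.filter_congr fun f _ => ?_
        rw [Finset.forall_mem_insert, and_comm]
      · rw [Finset.forall_mem_insert]
        exact ⟨hu, hHU'⟩
    have hclose : ∑ f ∈ ((matchings (H ∪ insert u U)).filter (fun f => ∀ x ∈ H, x < f x)).filter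
        (fun f => ¬ u < f u), q ^ (crossings f).card =
        (∑ a ∈ Finset.range H.card, q ^ a) * pathWeight q U.card (H.card - 1) := by
      have hmaps : ∀ f ∈ ((matchings (H ∪ insert u U)).filter
          (fun f => ∀ x ∈ H, x < f x)).filter (fun f => ¬ u < f u), f u ∈ H := by
        intro f hf
        simp only [Finset.mem_filter] at hf
        have h1 : f u ∈ H ∪ insert u U := apply_mem_of_mem_matchings hf.1.1 (by simp)
        have h2 : f u ≠ u := ((mem_matchings.1 hf.1.1).2 u).2 (by simp)
        rw [Finset.mem_union, Finset.mem_insert] at h1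
        rcases h1 with h1 | h1 | h1
        · exact h1
        · exact absurd h1 h2
        · exact absurd (hu _ h1) hf.2
      rw [← Finset.sum_fiberwise_of_maps_to hmaps, ← sum_pow_card_filter_lt, Finset.sum_mul]
      refine Finset.sum_congr rfl fun x hx => ?_
      have hxu := hHu x hx
      have hxU : x ∉ U := fun h => lt_asymm hxu (hu x h)
      rw [← Finset.card_erase_of_mem hx, ← ih (H.erase x) fun y hy =>
        hHU' y (Finset.mem_of_mem_erase hy), Finset.mul_sum]
      refine Finset.sum_nbij' (fun f => restrict ((H.erase x) ∪ U) f)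
        (fun g z => if z = x then u else if z = u then x else g z) ?_ ?_ ?_ ?_ ?_
      · intro f hf
        simp only [Finset.mem_filter] at hf ⊢
        obtain ⟨⟨⟨hf, hH⟩, -⟩, hfu⟩ := hf
        have hf' := mem_matchings.1 hf
        have hfx : f x = u := by rw [← hfu, hf'.1]
        refine ⟨restrict_mem_matchings hf ?_ ?_, ?_⟩
        · exact Finset.union_subset_union (Finset.erase_subset _ _) (Finset.subset_insert _ _)
        · intro y hy
          have hyx : y ≠ x := by
            rintro rfl
            simp [hxU] at hy
          have hyu : y ≠ u := by
            rintro rfl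
            simp [huU, huH] at hy
          have h1 : f y ∈ H ∪ insert u U := apply_mem_of_mem_matchings hf
            (Finset.union_subset_union (Finset.erase_subset _ _) (Finset.subset_insert _ _) hy)
          have h2 : f y ≠ x := fun h => hyu (by rw [← hfx, ← h, hf'.1])
          have h3 : f y ≠ u := fun h => hyx (by rw [← hfu, ← h, hf'.1])
          simp only [Finset.mem_union, Finset.mem_insert, Finset.mem_erase] at h1 ⊢
          tauto
        · intro y hy
          rw [restrict_of_mem (Finset.mem_union_left _ hy)]
          exact hH y (Finset.mem_of_mem_erase hy)
      · intro g hg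
        simp only [Finset.mem_filter] at hg ⊢
        obtain ⟨hg, hH⟩ := hg
        have hg' := mem_matchings.1 hg
        have gx : g x = x := by
          by_contra h
          have := (hg'.2 x).1 h
          simp [hxU] at this
        have gu : g u = u := by
          by_contra h
          have := (hg'.2 u).1 h
          simp [huU, huH] at this
        have hgx : ∀ z, z ≠ x → g z ≠ x := fun z hz h => hz (by rw [← hg'.1 z, h, gx])
        have hgu : ∀ z, z ≠ u → g z ≠ u := fun z hz h => hz (by rw [← hg'.1 z, h, gu])
        refine ⟨⟨⟨mem_matchings.2 ⟨fun z => ?_, fun z => ?_⟩, fun y hy => ?_⟩, ?_⟩, ?_⟩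
        · by_cases hzx : z = x
          · simp [hzx, hxu.ne']
          · by_cases hzu : z = u
            · simp [hzu, hxu.ne']
            · simp [hzx, hzu, hgx z hzx, hgu z hzu, hg'.1]
        · by_cases hzx : z = x
          · simp [hzx, hxu.ne', hx]
          · by_cases hzu : z = u
            · simp [hzu, hxu.ne', hxu.ne]
            · have := hg'.2 z
              simp only [Finset.mem_union, Finset.mem_erase, Finset.mem_insert] at this ⊢
              simp only [hzx, hzu, if_false]
              tauto
        · by_cases hyx : y = x
          · simp [hyx, hxu]
          · simp only [hyx, (hHu y hy).ne, if_false]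
            exact hH y (Finset.mem_erase.2 ⟨hyx, hy⟩)
        · simp [hxu.ne', hxu.le]
        · simp [hxu.ne']
      · intro f hf
        simp only [Finset.mem_filter] at hf
        obtain ⟨⟨⟨hf, hH⟩, -⟩, hfu⟩ := hf
        have hf' := mem_matchings.1 hf
        have hfx : f x = u := by rw [← hfu, hf'.1]
        funext z
        by_cases hzx : z = x
        · simp [hzx, hfx]
        · by_cases hzu : z = u
          · simp [hzu, hfu, hxu.ne']
          · simp only [hzx, hzu, if_false]
            by_cases hz : z ∈ (H.erase x) ∪ U
            · exact restrict_of_mem hz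
            · rw [restrict_of_notMem hz]
              by_contra hne
              have := (hf'.2 z).1 (Ne.symm hne)
              simp only [Finset.mem_union, Finset.mem_insert, Finset.mem_erase] at this hz
              tauto
      · intro g hg
        simp only [Finset.mem_filter] at hg
        obtain ⟨hg, hH⟩ := hg
        have hg' := mem_matchings.1 hg
        funext z
        by_cases hz : z ∈ (H.erase x) ∪ U
        · rw [restrict_of_mem hz, if_neg, if_neg]
          · rintro rfl
            simp [huU, huH] at hz
          · rintro rfl
            simp [hxU] at hz
        · rw [restrict_of_notMem hz]
          by_contra hne
          exact hz ((hg'.2 z).1 (Ne.symm hne))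
      · intro f hf
        simp only [Finset.mem_filter] at hf
        obtain ⟨⟨⟨hf, hH⟩, -⟩, hfu⟩ := hf
        rw [card_crossings_eq_add hHu hu hf hH hx hfu, pow_add]
    rw [hopen, hclose, Finset.card_insert_of_notMem huU]
    rcases Nat.eq_zero_or_pos H.card with h | h
    · rw [h, pathWeight]
      simp
    · obtain ⟨k, hk⟩ := Nat.exists_eq_succ_of_ne_zero h.ne'
      rw [hk, Nat.succ_eq_add_one, Nat.add_sub_cancel, pathWeight]

/-- The generating function of the matchings of `T` by crossings depends only on the size
of `T`. -/
lemma sum_matchings_pow_card_crossings {R : Type*} [CommSemiring R] (q : R) (T : Finset α) :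
    ∑ f ∈ matchings T, q ^ (crossings f).card = pathWeight q T.card 0 := by
  have := sum_pow_card_crossings q ∅ T (by simp)
  simpa using this

end Matchings

/-! ### Upper bounds for path weights -/

lemma pathWeight_zero_succ_succ {R : Type*} [CommSemiring R] (u h : ℕ) :
    pathWeight (0 : R) (u + 1) (h + 1) = pathWeight 0 u (h + 2) + pathWeight 0 u h := by
  rw [pathWeight, Finset.sum_range_succ']
  simp

lemma pathWeight_nonneg {q : ℝ} (hq : 0 ≤ q) (u h : ℕ) : 0 ≤ pathWeight q u h := by
  induction u generalizing h with
  | zero => cases h <;> simp [pathWeight]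
  | succ u ih =>
    cases h with
    | zero => exact ih 1
    | succ h =>
      rw [pathWeight]
      have := ih (h + 2)
      have := ih h
      positivity

/-- A down-step has weight at most `1 / (1 - q)`, and `(u + h) / 2` of the `u` steps are
down-steps. -/
lemma pathWeight_mul_sqrt_pow_le {q : ℝ} (hq : 0 ≤ q) (hq1 : q ≤ 1) (u h : ℕ) :
    pathWeight q u h * √(1 - q) ^ (u + h) ≤ pathWeight 0 u h := by
  have h1q : 0 ≤ 1 - q := by linarith
  induction u generalizing h with
  | zero => cases h <;> simp [pathWeight]
  | succ u ih =>
    cases h with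
    | zero => exact ih 1
    | succ h =>
      rw [pathWeight_zero_succ_succ, pathWeight, add_mul]
      refine add_le_add ?_ ?_
      · have := ih (h + 2)
        rwa [show u + (h + 2) = u + 1 + (h + 1) by ring] at this
      · refine le_trans ?_ (ih h)
        have hgeom : (∑ a ∈ Finset.range (h + 1), q ^ a) * (1 - q) ≤ 1 := by
          rw [geom_sum_mul_neg]
          have := pow_nonneg hq (h + 1)
          linarith
        have hW := pathWeight_nonneg hq u h
        calc _ = (∑ a ∈ Finset.range (h + 1), q ^ a) * (1 - q) *
              (pathWeight q u h * √(1 - q) ^ (u + h)) := by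
              rw [show u + 1 + (h + 1) = (u + h) + 2 by ring, pow_add, Real.sq_sqrt h1q]
              ring
          _ ≤ 1 * (pathWeight q u h * √(1 - q) ^ (u + h)) := by gcongr
          _ = _ := one_mul _

/-- The number of visits to `0` of a simple random walk killed when it leaves the nonnegative
integers has mean `2`, from every starting point. -/
lemma sum_pathWeight_zero_div_two_pow_le (N h : ℕ) :
    ∑ u ∈ Finset.range N, pathWeight (0 : ℝ) u h / 2 ^ u ≤ 2 := by
  induction N generalizing h with
  | zero => simp
  | succ N ih =>
    rw [Finset.sum_range_succ']
    cases h with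
    | zero =>
      have h1 : ∀ u, pathWeight (0 : ℝ) (u + 1) 0 / 2 ^ (u + 1) =
          (pathWeight (0 : ℝ) u 1 / 2 ^ u) / 2 := fun u => by
        rw [pathWeight, pow_succ]; ring
      simp only [h1, ← Finset.sum_div]
      have := ih 1
      simp only [pathWeight, pow_zero, div_one]
      linarith
    | succ h =>
      have h1 : ∀ u, pathWeight (0 : ℝ) (u + 1) (h + 1) / 2 ^ (u + 1) =
          (pathWeight (0 : ℝ) u (h + 2) / 2 ^ u + pathWeight (0 : ℝ) u h / 2 ^ u) / 2 :=
        fun u => by rw [pathWeight_zero_succ_succ, pow_succ]; ring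
      simp only [h1, ← Finset.sum_div, Finset.sum_add_distrib]
      have := ih (h + 2)
      have := ih h
      simp only [pathWeight, pow_zero, div_one]
      linarith

/-- The generating function of matchings at the point `(1 - q) / 4` is at most `2`. -/
lemma sum_pathWeight_mul_pow_le {q : ℝ} (hq : 0 ≤ q) (hq1 : q ≤ 1) (N : ℕ) :
    ∑ u ∈ Finset.range N, pathWeight q u 0 * (√(1 - q) / 2) ^ u ≤ 2 := by
  refine le_trans (Finset.sum_le_sum fun u _ => ?_) (sum_pathWeight_zero_div_two_pow_le N 0)
  rw [div_pow, ← mul_div_assoc]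
  have := pathWeight_mul_sqrt_pow_le hq hq1 u 0
  rw [add_zero] at this
  gcongr

lemma pathWeight_zero_le (u h : ℕ) : pathWeight (0 : ℝ) u h ≤ 2 ^ u := by
  induction u generalizing h with
  | zero => cases h <;> simp [pathWeight]
  | succ u ih =>
    cases h with
    | zero =>
      rw [pathWeight, pow_succ]
      have := ih 1
      have : (0 : ℝ) < 2 ^ u := by positivity
      linarith
    | succ h =>
      rw [pathWeight_zero_succ_succ, pow_succ]
      have := ih (h + 2)
      have := ih h
      linarith

lemma pathWeight_half_le (k : ℕ) : pathWeight (1 / 2 : ℝ) (2 * k) 0 ≤ 8 ^ k := by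
  have h1 := pathWeight_mul_sqrt_pow_le (q := 1 / 2) (by norm_num) (by norm_num) (2 * k) 0
  have h2 := pathWeight_zero_le (2 * k) 0
  rw [add_zero, pow_mul, Real.sq_sqrt (by norm_num)] at h1
  have h3 := h1.trans h2
  rw [pow_mul] at h3
  norm_num at h3 ⊢
  calc pathWeight (1 / 2 : ℝ) (2 * k) 0
      = (pathWeight (1 / 2 : ℝ) (2 * k) 0 * (1 / 2) ^ k) * 2 ^ k := by
        rw [mul_assoc, ← mul_pow]; norm_num
    _ ≤ 4 ^ k * 2 ^ k := by gcongr
    _ = 8 ^ k := by rw [← mul_pow]; norm_num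

/-! ### Dyck paths -/

/-- The reflection principle. -/
lemma pathWeight_zero_add_choose (u h d : ℕ) (hd : u + h = 2 * d) :
    pathWeight (0 : ℕ) u h + u.choose (d + 1) = u.choose d := by
  induction u generalizing h d with
  | zero =>
    cases h with
    | zero =>
      obtain rfl : d = 0 := by omega
      simp [pathWeight]
    | succ h =>
      obtain ⟨d, rfl⟩ : ∃ e, d = e + 1 := ⟨d - 1, by omega⟩
      simp [pathWeight]
  | succ u ih =>
    obtain ⟨d, rfl⟩ : ∃ e, d = e + 1 := ⟨d - 1, by omega⟩
    cases h with
    | zero =>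
      have h1 := ih 1 (d + 1) (by omega)
      rw [pathWeight, Nat.choose_succ_succ u d, Nat.choose_succ_succ u (d + 1)]
      have : u.choose d = u.choose (d + 1) := by
        rw [← Nat.choose_symm_of_eq_add (show u = d + (d + 1) by omega)]
      simp only [Nat.succ_eq_add_one] at *
      omega
    | succ h =>
      have h1 := ih (h + 2) (d + 1) (by omega)
      have h2 := ih h d (by omega)
      rw [pathWeight_zero_succ_succ, Nat.choose_succ_succ u d, Nat.choose_succ_succ u (d + 1)]
      simp only [Nat.succ_eq_add_one] at *
      omega

lemma pathWeight_zero_two_mul (n : ℕ) : pathWeight (0 : ℕ) (2 * n) 0 = catalan n := by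
  have h := pathWeight_zero_add_choose (2 * n) 0 n rfl
  have h1 : (n + 1) * catalan n = (2 * n).choose n := by
    rw [succ_mul_catalan_eq_centralBinom, Nat.centralBinom]
  have h2 : (2 * n).choose (n + 1) * (n + 1) = (2 * n).choose n * n := by
    rw [Nat.choose_succ_right_eq]
    congr 1
    omega
  have h3 : (pathWeight (0 : ℕ) (2 * n) 0 + (2 * n).choose (n + 1)) * (n + 1) =
      (2 * n).choose n * (n + 1) := by rw [h]
  have h4 : (n + 1) * pathWeight (0 : ℕ) (2 * n) 0 = (n + 1) * catalan n := by
    rw [h1]; nlinarith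
  exact Nat.eq_of_mul_eq_mul_left (Nat.succ_pos n) h4

lemma four_pow_le_mul_catalan {n : ℕ} (hn : 0 < n) :
    4 ^ n ≤ 2 * n * (n + 1) * catalan n := by
  have := Nat.four_pow_le_two_mul_self_mul_centralBinom n hn
  rw [← succ_mul_catalan_eq_centralBinom] at this
  linarith

lemma catalan_succ_le (n : ℕ) : catalan (n + 1) ≤ 4 * catalan n := by
  have h1 := Nat.succ_mul_centralBinom_succ n
  rw [← succ_mul_catalan_eq_centralBinom, ← succ_mul_catalan_eq_centralBinom] at h1
  have h2 : (n + 1) * ((n + 2) * catalan (n + 1)) = (n + 1) * (2 * (2 * n + 1) * catalan n) := by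
    rw [show n + 2 = n + 1 + 1 from rfl, h1]; ring
  have h3 := Nat.eq_of_mul_eq_mul_left (Nat.succ_pos n) h2
  by_contra hlt
  push Not at hlt
  nlinarith

lemma catalan_add_le (n L : ℕ) : catalan (n + L) ≤ 4 ^ L * catalan n := by
  induction L with
  | zero => simp
  | succ L ih =>
    calc catalan (n + L + 1) ≤ 4 * catalan (n + L) := catalan_succ_le _
      _ ≤ 4 * (4 ^ L * catalan n) := by gcongr
      _ = _ := by ring

/-! ### Lower bounds for path weights -/

open Polynomial in
lemma coeff_mul_le_coeff_mul {p p' r r' : ℕ[X]} (h : ∀ m, p.coeff m ≤ p'.coeff m)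
    (h' : ∀ m, r.coeff m ≤ r'.coeff m) (m : ℕ) : (p * r).coeff m ≤ (p' * r').coeff m := by
  rw [coeff_mul, coeff_mul]
  exact Finset.sum_le_sum fun x _ => Nat.mul_le_mul (h _) (h' _)

open Polynomial in
lemma coeff_geom_sum_mono {a b : ℕ} (hab : a ≤ b) (m : ℕ) :
    (∑ i ∈ Finset.range a, (X : ℕ[X]) ^ i).coeff m ≤
      (∑ i ∈ Finset.range b, (X : ℕ[X]) ^ i).coeff m := by
  rw [finsetSum_coeff, finsetSum_coeff]
  exact Finset.sum_le_sum_of_subset (Finset.range_mono hab)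

open Polynomial in
/-- The path of `L` down-steps has weight with constant term `1`. -/
lemma one_le_coeff_pathWeight_self (L : ℕ) : 1 ≤ (pathWeight (X : ℕ[X]) L L).coeff 0 := by
  induction L with
  | zero => simp [pathWeight]
  | succ L ih =>
    rw [pathWeight, coeff_add, mul_coeff_zero, finsetSum_coeff, Finset.sum_range_succ']
    simp only [coeff_X_pow]
    simp
    omega

/-- Only the paths that stay at height at least `L` until their last `L` steps, which are
down-steps of weight `1`, are counted, and the other down-steps are given
weight `1 + q + ⋯ + q ^ L`. -/
lemma mul_coeff_le_coeff_pathWeight (L u h r m : ℕ) (hr : u + h = 2 * r) :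
    pathWeight (0 : ℕ) u h *
        ((∑ a ∈ Finset.range (L + 1), (Polynomial.X : Polynomial ℕ) ^ a) ^ r).coeff m ≤
      (pathWeight (Polynomial.X : Polynomial ℕ) (u + L) (h + L)).coeff m := by
  open Polynomial in
  set Q := ∑ a ∈ Finset.range (L + 1), (X : ℕ[X]) ^ a with hQ
  induction u generalizing h r m with
  | zero =>
    cases h with
    | zero =>
      obtain rfl : r = 0 := by omega
      rw [pow_zero, coeff_one]
      split_ifs with h
      · subst h
        simpa [pathWeight] using one_le_coeff_pathWeight_self L
      · simp
    | succ h => simp [pathWeight]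
  | succ u ih =>
    obtain ⟨r, rfl⟩ : ∃ e, r = e + 1 := ⟨r - 1, by omega⟩
    cases h with
    | zero =>
      have h1 := ih 1 (r + 1) m (by omega)
      rw [pathWeight, show u + 1 + L = u + L + 1 by ring, zero_add]
      refine h1.trans ?_
      rw [add_comm 1 L]
      cases L with
      | zero =>
        rw [pathWeight]
        exact le_rfl
      | succ L =>
        rw [pathWeight, coeff_add]
        exact Nat.le_add_right _ _
    | succ h =>
      have h1 := ih (h + 2) (r + 1) m (by omega)
      have h2 : ∀ m, (C (pathWeight (0 : ℕ) u h) * Q ^ r).coeff m ≤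
          (pathWeight (X : ℕ[X]) (u + L) (h + L)).coeff m := fun m => by
        rw [coeff_C_mul]
        exact ih h r m (by omega)
      rw [pathWeight_zero_succ_succ, show u + 1 + L = u + L + 1 by ring,
        show h + 1 + L = h + L + 1 by ring, pathWeight, coeff_add, add_mul]
      refine Nat.add_le_add ?_ ?_
      · rwa [show h + L + 2 = h + 2 + L by ring]
      · have h3 := coeff_mul_le_coeff_mul
          (coeff_geom_sum_mono (show L + 1 ≤ h + L + 1 by omega)) h2 m
        rw [← hQ, mul_left_comm, ← pow_succ', coeff_C_mul] at h3
        exact h3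

/-- The number of multisets of size `m - d` on `r` letters, which is `0` if `m < d`. -/
def shiftedMultichoose (r m d : ℕ) : ℕ := if d ≤ m then r.multichoose (m - d) else 0

lemma shiftedMultichoose_eq_add (r m d : ℕ) :
    shiftedMultichoose (r + 1) m d =
      shiftedMultichoose r m d + shiftedMultichoose (r + 1) m (d + 1) := by
  unfold shiftedMultichoose
  rcases lt_trichotomy d m with h | rfl | h
  · obtain ⟨k, rfl⟩ : ∃ k, m = d + (k + 1) := ⟨m - d - 1, by omega⟩
    rw [if_pos (by omega), if_pos (by omega), if_pos (by omega), Nat.add_sub_cancel_left,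
      show d + (k + 1) - (d + 1) = k by omega, Nat.multichoose_succ_succ]
  · simp
  · rw [if_neg (by omega), if_neg (by omega), if_neg (by omega)]

lemma sum_shiftedMultichoose_add (r m d L : ℕ) :
    ∑ a ∈ Finset.range L, shiftedMultichoose r m (a + d) + shiftedMultichoose (r + 1) m (L + d) =
      shiftedMultichoose (r + 1) m d := by
  induction L with
  | zero => simp
  | succ L ih =>
    rw [Finset.sum_range_succ, ← ih, shiftedMultichoose_eq_add r m (L + d),
      show L + 1 + d = L + d + 1 by ring]
    ring

open Polynomial in
/-- Bonferroni's inequality for the number of ways to write `m` as an ordered sum of `r` terms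
that are all at most `L`. -/
lemma multichoose_le_coeff_add (L r m : ℕ) :
    r.multichoose m ≤ ((∑ a ∈ Finset.range (L + 1), (X : ℕ[X]) ^ a) ^ r).coeff m +
      r * shiftedMultichoose r m (L + 1) := by
  induction r generalizing m with
  | zero =>
    cases m <;> simp [coeff_one]
  | succ r ih =>
    set Q := ∑ a ∈ Finset.range (L + 1), (X : ℕ[X]) ^ a with hQ
    have h1 := sum_shiftedMultichoose_add r m 0 (L + 1)
    have h2 := sum_shiftedMultichoose_add r m (L + 1) (L + 1)
    have h3 : ∑ a ∈ Finset.range (L + 1), shiftedMultichoose r m (a + 0) ≤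
        ∑ a ∈ Finset.range (L + 1), ((X ^ a * Q ^ r).coeff m +
          r * shiftedMultichoose r m (a + (L + 1))) := by
      refine Finset.sum_le_sum fun a _ => ?_
      rw [coeff_X_pow_mul']
      by_cases ha : a ≤ m
      · have h4 := ih (m - a)
        have h5 : shiftedMultichoose r (m - a) (L + 1) =
            shiftedMultichoose r m (a + (L + 1)) := by
          unfold shiftedMultichoose
          simp only [show L + 1 ≤ m - a ↔ a + (L + 1) ≤ m by omega,
            show m - a - (L + 1) = m - (a + (L + 1)) by omega]
        rw [h5] at h4
        simpa [shiftedMultichoose, ha] using h4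
      · simp [shiftedMultichoose, ha]
    have h6 : (Q ^ (r + 1)).coeff m = ∑ a ∈ Finset.range (L + 1), (X ^ a * Q ^ r).coeff m := by
      rw [pow_succ', hQ, Finset.sum_mul, finsetSum_coeff]
    have h7 : shiftedMultichoose (r + 1) m 0 = (r + 1).multichoose m := by
      simp [shiftedMultichoose]
    rw [Finset.sum_add_distrib, ← Finset.mul_sum, ← h6] at h3
    rw [← h7, ← h1, add_zero, add_mul, one_mul]
    have h8 : ∑ a ∈ Finset.range (L + 1), shiftedMultichoose r m (a + (L + 1)) ≤
        shiftedMultichoose (r + 1) m (L + 1) := by omega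
    have h9 := Nat.mul_le_mul_left r h8
    omega

lemma succ_mul_multichoose_succ_right (r m : ℕ) :
    (m + 1) * r.multichoose (m + 1) = (r + m) * r.multichoose m := by
  cases r with
  | zero => cases m <;> simp
  | succ s =>
    rw [Nat.multichoose_eq, Nat.multichoose_eq, show s + 1 + (m + 1) - 1 = s + m + 1 by omega,
      show s + 1 + m - 1 = s + m by omega, mul_comm, ← Nat.add_one_mul_choose_eq]
    ring

lemma mul_multichoose_succ_left (r m : ℕ) :
    r * (r + 1).multichoose m = (r + m) * r.multichoose m := by
  cases r with
  | zero => cases m <;> simp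
  | succ s =>
    have h := Nat.choose_mul_succ_eq (s + m) m
    rw [show s + m + 1 - m = s + 1 by omega] at h
    rw [Nat.multichoose_eq, Nat.multichoose_eq, show s + 1 + 1 + m - 1 = s + m + 1 by omega,
      show s + 1 + m - 1 = s + m by omega, mul_comm, ← h]
    ring

lemma pow_mul_shiftedMultichoose_le {r m : ℕ} (h : 13 * m + 1 ≤ r) (d : ℕ) :
    14 ^ d * shiftedMultichoose r m d ≤ r.multichoose m := by
  unfold shiftedMultichoose
  split_ifs with hd
  · induction d with
    | zero => simp
    | succ d ih =>
      refine le_trans ?_ (ih (by omega))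
      obtain ⟨k, hk⟩ : ∃ k, m = d + 1 + k := ⟨m - (d + 1), by omega⟩
      rw [show m - d = k + 1 by omega, show m - (d + 1) = k by omega, pow_succ, mul_assoc]
      refine Nat.mul_le_mul_left _ (Nat.le_of_mul_le_mul_left ?_ (Nat.succ_pos k))
      rw [Nat.succ_eq_add_one, succ_mul_multichoose_succ_right, ← mul_assoc]
      exact Nat.mul_le_mul_right _ (by omega)
  · simp

lemma two_pow_mul_multichoose_add_le {r m : ℕ} (h : 2 * m ≤ r) (L : ℕ) :
    2 ^ L * (r + L).multichoose m ≤ 3 ^ L * r.multichoose m := by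
  induction L with
  | zero => simp
  | succ L ih =>
    have h1 : 2 * (r + L + 1).multichoose m ≤ 3 * (r + L).multichoose m := by
      rcases Nat.eq_zero_or_pos (r + L) with h0 | h0
      · obtain rfl : m = 0 := by omega
        simp
      · refine Nat.le_of_mul_le_mul_left ?_ h0
        rw [mul_left_comm, mul_multichoose_succ_left, ← mul_assoc, ← mul_assoc]
        exact Nat.mul_le_mul_right _ (by omega)
    calc 2 ^ (L + 1) * (r + (L + 1)).multichoose m
        = 2 ^ L * (2 * (r + L + 1).multichoose m) := by rw [pow_succ]; ring_nf
      _ ≤ 2 ^ L * (3 * (r + L).multichoose m) := by gcongr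
      _ = 3 * (2 ^ L * (r + L).multichoose m) := by ring
      _ ≤ 3 * (3 ^ L * r.multichoose m) := by gcongr
      _ = _ := by ring

/-- Starting a path with `L` up-steps does not change its weight. -/
lemma coeff_pathWeight_le_add (u h L m : ℕ) :
    (pathWeight (Polynomial.X : Polynomial ℕ) u (h + L)).coeff m ≤
      (pathWeight (Polynomial.X : Polynomial ℕ) (u + L) h).coeff m := by
  induction L generalizing h with
  | zero => exact le_rfl
  | succ L ih =>
    have h1 := ih (h + 1)
    rw [show h + (L + 1) = h + 1 + L by ring]
    refine h1.trans ?_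
    rw [← add_assoc u L 1]
    cases h with
    | zero =>
      rw [pathWeight]
    | succ h =>
      rw [pathWeight, Polynomial.coeff_add]
      exact Nat.le_add_right _ _

/-- The number of matchings of `2 * n` points with `m` crossings is, up to a factor `4 * n`, at
least the number of Dyck paths with arbitrary labels of sum `m` on the down-steps. The height
restriction on the labels costs only this factor, because for small `m` labels of
logarithmic size do not occur in a typical labelling. -/
lemma catalan_mul_multichoose_le {n m : ℕ} (hn : 98 ≤ n) (hm : 14 * m ≤ n) :
    catalan n * n.multichoose m ≤
      4 * n * (pathWeight (Polynomial.X : Polynomial ℕ) (2 * n) 0).coeff m := by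
  -- With `14 ^ (L + 1) > 2 * n`, less than half of the labellings have a label above `L`.
  obtain ⟨L, hL⟩ : ∃ L, Nat.log 14 (2 * n) = L := ⟨_, rfl⟩
  have hL1 : 14 ^ L ≤ 2 * n := by
    rw [← hL]; exact Nat.pow_log_le_self 14 (by omega)
  have hL2 : 2 * n < 14 ^ (L + 1) := by
    rw [← hL]; exact Nat.lt_pow_succ_log_self (by norm_num) _
  have hLn : 14 * (L + 1) ≤ n := by
    -- `n ≥ 98` gives `14 ^ 2 ≤ 2 * n`, and `28 * (L + 1) ≤ 14 ^ L` holds from `L = 2` on.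
    have h2 : 2 ≤ L := by
      by_contra h
      have : 14 ^ (L + 1) ≤ 14 ^ 2 := Nat.pow_le_pow_right (by norm_num) (by omega)
      omega
    have h3 : 28 * (L + 1) ≤ 14 ^ L := by
      clear hL hL1 hL2
      induction L, h2 using Nat.le_induction with
      | base => norm_num
      | succ k hk ih => rw [pow_succ]; omega
    omega
  obtain ⟨r, rfl⟩ : ∃ r, n = r + L := ⟨n - L, by omega⟩
  have h1 := mul_coeff_le_coeff_pathWeight L (2 * r) 0 r m rfl
  have h2 := coeff_pathWeight_le_add (2 * r + L) 0 L m
  rw [pathWeight_zero_two_mul] at h1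
  rw [show 2 * r + L + L = 2 * (r + L) by ring] at h2
  have h3 := h1.trans h2
  set c := (pathWeight (Polynomial.X : Polynomial ℕ) (2 * (r + L)) 0).coeff m
  have h4 := multichoose_le_coeff_add L r m
  set b := ((∑ a ∈ Finset.range (L + 1), (Polynomial.X : Polynomial ℕ) ^ a) ^ r).coeff m
  have h5 := pow_mul_shiftedMultichoose_le (r := r) (m := m) (by omega) (L + 1)
  have h6 : r.multichoose m ≤ 2 * b := by
    have : 2 * (r * shiftedMultichoose r m (L + 1)) ≤ r.multichoose m := by
      refine le_trans ?_ h5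
      rw [← mul_assoc]
      exact Nat.mul_le_mul_right _ (by omega)
    omega
  have h7 := two_pow_mul_multichoose_add_le (r := r) (m := m) (by omega) L
  have h8 := catalan_add_le r L
  refine Nat.le_of_mul_le_mul_left ?_ (show 0 < 2 ^ L by positivity)
  calc 2 ^ L * (catalan (r + L) * (r + L).multichoose m)
      = catalan (r + L) * (2 ^ L * (r + L).multichoose m) := by ring
    _ ≤ 4 ^ L * catalan r * (3 ^ L * r.multichoose m) := Nat.mul_le_mul h8 h7
    _ ≤ 4 ^ L * catalan r * (3 ^ L * (2 * b)) := by gcongr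
    _ = 2 ^ L * (6 ^ L * (2 * (catalan r * b))) := by
      rw [show 4 ^ L = 2 ^ L * 2 ^ L by rw [← mul_pow]; rfl,
        show 6 ^ L = 2 ^ L * 3 ^ L by rw [← mul_pow]; rfl]
      ring
    _ ≤ 2 ^ L * (14 ^ L * (2 * c)) := by gcongr; norm_num
    _ ≤ 2 ^ L * (2 * (r + L) * (2 * c)) := by gcongr
    _ = 2 ^ L * (4 * (r + L) * c) := by ring

/-! ### The mode of the binomial distribution -/

lemma binomial_term_le_succ {n m j : ℕ} (hj : j < m) :
    m ^ j * n ^ (n + m - j) * (n + m).choose j ≤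
      m ^ (j + 1) * n ^ (n + m - (j + 1)) * (n + m).choose (j + 1) := by
  have h := Nat.choose_succ_right_eq (n + m) j
  rw [show n + m - j = n + m - (j + 1) + 1 by omega, pow_succ, pow_succ]
  have h1 : n * (n + m).choose j ≤ m * (n + m).choose (j + 1) := by
    refine Nat.le_of_mul_le_mul_right ?_ (Nat.succ_pos j)
    rw [Nat.succ_eq_add_one, mul_assoc m, h]
    have : n * (j + 1) ≤ m * (n + m - j) := by
      rw [mul_comm m]
      exact Nat.mul_le_mul (by omega) (by omega)
    nlinarith [Nat.zero_le ((n + m).choose j)]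
  calc _ = m ^ j * n ^ (n + m - (j + 1)) * (n * (n + m).choose j) := by ring
    _ ≤ m ^ j * n ^ (n + m - (j + 1)) * (m * (n + m).choose (j + 1)) := by gcongr
    _ = _ := by ring

lemma binomial_term_succ_le {n m j : ℕ} (hj : m ≤ j) (hj' : j < n + m) :
    m ^ (j + 1) * n ^ (n + m - (j + 1)) * (n + m).choose (j + 1) ≤
      m ^ j * n ^ (n + m - j) * (n + m).choose j := by
  have h := Nat.choose_succ_right_eq (n + m) j
  rw [show n + m - j = n + m - (j + 1) + 1 by omega, pow_succ, pow_succ]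
  have h1 : m * (n + m).choose (j + 1) ≤ n * (n + m).choose j := by
    refine Nat.le_of_mul_le_mul_right ?_ (Nat.succ_pos j)
    rw [Nat.succ_eq_add_one, mul_assoc m, h]
    have : m * (n + m - j) ≤ n * (j + 1) := by
      rw [mul_comm m]
      exact Nat.mul_le_mul (by omega) (by omega)
    nlinarith [Nat.zero_le ((n + m).choose j)]
  calc _ = m ^ j * n ^ (n + m - (j + 1)) * (m * (n + m).choose (j + 1)) := by ring
    _ ≤ m ^ j * n ^ (n + m - (j + 1)) * (n * (n + m).choose j) := by gcongr
    _ = _ := by ring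

/-- The binomial distribution with `n + m` trials and success probability `m / (n + m)` has its
mode at `m`. -/
lemma add_pow_le_mul_choose (n m : ℕ) :
    (n + m) ^ (n + m) ≤ (n + m + 1) * (m ^ m * n ^ n * (n + m).choose m) := by
  have hle : ∀ j ∈ Finset.range (n + m + 1), m ^ j * n ^ (n + m - j) * (n + m).choose j ≤
      m ^ m * n ^ n * (n + m).choose m := by
    intro j hj
    rw [Finset.mem_range] at hj
    have hmm : m ^ m * n ^ n * (n + m).choose m =
      m ^ m * n ^ (n + m - m) * (n + m).choose m := by rw [Nat.add_sub_cancel]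
    rw [hmm]
    rcases le_total j m with h | h
    · have : ∀ k, j ≤ k → k ≤ m → m ^ j * n ^ (n + m - j) * (n + m).choose j ≤
          m ^ k * n ^ (n + m - k) * (n + m).choose k := by
        intro k hk
        induction k, hk using Nat.le_induction with
        | base => exact fun _ => le_rfl
        | succ k hk ih => exact fun h' => (ih (by omega)).trans (binomial_term_le_succ (by omega))
      exact this m h le_rfl
    · have : ∀ k, m ≤ k → k ≤ n + m → m ^ k * n ^ (n + m - k) * (n + m).choose k ≤
          m ^ m * n ^ (n + m - m) * (n + m).choose m := by
        intro k hk
        induction k, hk using Nat.le_induction with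
        | base => exact fun _ => le_rfl
        | succ k hk ih =>
          exact fun h' => (binomial_term_succ_le hk (by omega)).trans (ih (by omega))
      exact this j h (by omega)
  have h := Finset.sum_le_card_nsmul _ _ _ hle
  rw [Finset.card_range, smul_eq_mul] at h
  refine le_trans (le_of_eq ?_) h
  rw [add_comm n m, add_pow]
  rfl

/-- The lower bound for the number of matchings with `m` crossings, in the form in which it is
compared with the generating function at `q = m / (n + m)`. -/
lemma one_le_mul_coeff_pathWeight {n m : ℕ} (hn : 98 ≤ n) (hm : 14 * m ≤ n) {q : ℝ}
    (hq : q = m / (n + m)) :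
    1 ≤ 64 * (n : ℝ) ^ 4 * ((pathWeight (Polynomial.X : Polynomial ℕ) (2 * n) 0).coeff m *
      q ^ m * ((1 - q) / 4) ^ n) := by
  have h1 := catalan_mul_multichoose_le hn hm
  set c := (pathWeight (Polynomial.X : Polynomial ℕ) (2 * n) 0).coeff m
  have h2 := four_pow_le_mul_catalan (n := n) (by omega)
  have h3 := add_pow_le_mul_choose n m
  have h4 := mul_multichoose_succ_left n m
  rw [Nat.multichoose_eq (n + 1), show n + 1 + m - 1 = n + m by omega] at h4
  have hn0 : (0 : ℝ) < n := by exact_mod_cast (show 0 < n by omega)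
  have hs : (0 : ℝ) < n + m := by positivity
  -- everything in one inequality between natural numbers
  have h5 : 4 ^ n * (n + m) ^ (n + m) ≤ 64 * n ^ 4 * (c * (m ^ m * n ^ n)) := by
    have h6 : (n + m).choose m ≤ 2 * n.multichoose m := by
      refine Nat.le_of_mul_le_mul_left ?_ (show 0 < n by omega)
      rw [h4, mul_left_comm, ← mul_assoc]
      exact Nat.mul_le_mul_right _ (by omega)
    calc 4 ^ n * (n + m) ^ (n + m)
        ≤ (2 * n * (n + 1) * catalan n) * ((n + m + 1) * (m ^ m * n ^ n * (n + m).choose m)) :=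
          Nat.mul_le_mul h2 h3
      _ ≤ (2 * n * (n + n) * catalan n) *
          ((n + n) * (m ^ m * n ^ n * (2 * n.multichoose m))) := by
          gcongr ?_ * ?_
          · gcongr; omega
          · gcongr ?_ * (_ * ?_)
            omega
      _ = 16 * n ^ 3 * (m ^ m * n ^ n) * (catalan n * n.multichoose m) := by ring
      _ ≤ 16 * n ^ 3 * (m ^ m * n ^ n) * (4 * n * c) := by gcongr
      _ = _ := by ring
  have h7 : (4 : ℝ) ^ n * (n + m) ^ (n + m) ≤ 64 * n ^ 4 * (c * (m ^ m * n ^ n)) := by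
    exact_mod_cast h5
  have hq1 : 1 - q = n / (n + m) := by
    rw [hq]; field_simp; ring
  rw [hq1, hq, div_div, div_pow, div_pow, mul_pow]
  have h8 : 64 * (n : ℝ) ^ 4 * (c * (m ^ m / (n + m) ^ m) * (n ^ n / ((n + m) ^ n * 4 ^ n))) =
      64 * n ^ 4 * (c * (m ^ m * n ^ n)) / (4 ^ n * (n + m) ^ (n + m)) := by
    rw [pow_add]
    field_simp
  rw [h8, le_div_iff₀ (by positivity), one_mul]
  exact h7

/-! ### Splitting a matching into independent parts -/

section Splitting

variable {α : Type*} [LinearOrder α] [Fintype α]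

lemma mem_of_mem_crossings_restrict {S : Finset α} {f : α → α} {p : α × α}
    (h : p ∈ crossings (restrict S f)) : p.1 ∈ S ∧ p.2 ∈ S ∧ p ∈ crossings f := by
  rw [mem_crossings] at h
  have h1 : p.1 ∈ S := by
    by_contra hS
    rw [restrict_of_notMem hS] at h
    exact lt_asymm h.1 h.2.1
  have h2 : p.2 ∈ S := by
    by_contra hS
    rw [restrict_of_notMem hS] at h
    exact lt_asymm h.2.1 h.2.2
  rw [restrict_of_mem h1, restrict_of_mem h2] at h
  exact ⟨h1, h2, mem_crossings.2 h⟩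

lemma card_crossings_restrict_add_le {S S' : Finset α} (hS : Disjoint S S') (f : α → α) :
    (crossings (restrict S f)).card + (crossings (restrict S' f)).card ≤ (crossings f).card := by
  rw [← Finset.card_union_of_disjoint]
  · refine Finset.card_le_card (Finset.union_subset ?_ ?_) <;>
    exact fun p hp => (mem_of_mem_crossings_restrict hp).2.2
  · rw [Finset.disjoint_left]
    exact fun p hp hp' => Finset.disjoint_left.1 hS (mem_of_mem_crossings_restrict hp).1
      (mem_of_mem_crossings_restrict hp').1

/-- Crossings between the two parts only lower the weight, since `q ≤ 1`. -/
lemma sum_pow_card_crossings_le_mul {q : ℝ} (hq : 0 ≤ q) (hq1 : q ≤ 1) {S S' : Finset α}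
    (hS : Disjoint S S') {F A B : Finset (α → α)} (hF : F ⊆ matchings (S ∪ S'))
    (hA : ∀ f ∈ F, restrict S f ∈ A) (hB : ∀ f ∈ F, restrict S' f ∈ B) :
    ∑ f ∈ F, q ^ (crossings f).card ≤
      (∑ f ∈ A, q ^ (crossings f).card) * ∑ f ∈ B, q ^ (crossings f).card := by
  rw [Finset.sum_mul_sum, ← Finset.sum_product']
  have hinj : Set.InjOn (fun f => (restrict S f, restrict S' f)) (F : Set (α → α)) := by
    intro f hf g hg h
    simp only [Prod.mk.injEq] at h
    funext x
    by_cases hx : x ∈ S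
    · simpa [restrict_of_mem hx] using congrFun h.1 x
    · by_cases hx' : x ∈ S'
      · simpa [restrict_of_mem hx'] using congrFun h.2 x
      · have hx2 : x ∉ S ∪ S' := by simp [hx, hx']
        have h1 := (mem_matchings.1 (hF hf)).2 x
        have h2 := (mem_matchings.1 (hF hg)).2 x
        rw [not_not.1 (mt h1.1 hx2), not_not.1 (mt h2.1 hx2)]
  calc ∑ f ∈ F, q ^ (crossings f).card
      ≤ ∑ f ∈ F, q ^ (crossings (restrict S f)).card * q ^ (crossings (restrict S' f)).card := by
        refine Finset.sum_le_sum fun f _ => ?_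
        rw [← pow_add]
        exact pow_le_pow_of_le_one hq hq1 (card_crossings_restrict_add_le hS f)
    _ = ∑ x ∈ F.image (fun f => (restrict S f, restrict S' f)),
          q ^ (crossings x.1).card * q ^ (crossings x.2).card := by
        rw [Finset.sum_image hinj]
    _ ≤ _ := by
        refine Finset.sum_le_sum_of_subset_of_nonneg ?_ fun _ _ _ => by positivity
        intro x hx
        obtain ⟨f, hf, rfl⟩ := Finset.mem_image.1 hx
        exact Finset.mem_product.2 ⟨hA f hf, hB f hf⟩

lemma sum_pow_card_crossings_le_prod {ι : Type*} [DecidableEq ι] {q : ℝ} (hq : 0 ≤ q)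
    (hq1 : q ≤ 1) (T : ι → Finset α) (hT : Pairwise fun i j => Disjoint (T i) (T j))
    (I : Finset ι) :
    ∑ f ∈ (matchings (I.biUnion T)).filter (fun f => ∀ i ∈ I, ∀ x ∈ T i, f x ∈ T i),
      q ^ (crossings f).card ≤ ∏ i ∈ I, pathWeight q (T i).card 0 := by
  induction I using Finset.induction_on with
  | empty =>
    refine (Finset.sum_le_sum_of_subset_of_nonneg (Finset.filter_subset _ _)
      fun _ _ _ => by positivity).trans ?_
    rw [sum_matchings_pow_card_crossings]
    simp [pathWeight]
  | insert i I hi ih =>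
    rw [Finset.prod_insert hi]
    have hdisj : Disjoint (T i) (I.biUnion T) := by
      rw [Finset.disjoint_biUnion_right]
      exact fun j hj => hT (by rintro rfl; exact hi hj)
    refine (sum_pow_card_crossings_le_mul hq hq1 hdisj (A := matchings (T i))
      (B := (matchings (I.biUnion T)).filter (fun f => ∀ i ∈ I, ∀ x ∈ T i, f x ∈ T i))
      ?_ ?_ ?_).trans ?_
    · rw [Finset.biUnion_insert]
      exact Finset.filter_subset _ _
    · intro f hf
      rw [Finset.mem_filter] at hf
      refine restrict_mem_matchings hf.1 ?_ (hf.2 i (Finset.mem_insert_self _ _))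
      exact Finset.subset_biUnion_of_mem T (Finset.mem_insert_self _ _)
    · intro f hf
      rw [Finset.mem_filter] at hf ⊢
      refine ⟨restrict_mem_matchings hf.1 ?_ ?_, ?_⟩
      · exact Finset.biUnion_subset_biUnion_of_subset_left T (Finset.subset_insert _ _)
      · intro x hx
        obtain ⟨j, hj, hxj⟩ := Finset.mem_biUnion.1 hx
        exact Finset.mem_biUnion.2 ⟨j, hj, hf.2 j (Finset.mem_insert_of_mem hj) x hxj⟩
      · intro j hj x hx
        rw [restrict_of_mem (Finset.mem_biUnion.2 ⟨j, hj, hx⟩)]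
        exact hf.2 j (Finset.mem_insert_of_mem hj) x hx
    · rw [sum_matchings_pow_card_crossings]
      exact mul_le_mul_of_nonneg_left ih (pathWeight_nonneg hq _ _)

/-! ### The gaps of a point set -/

/-- The number of points of `P` before `x`. -/
def rankIn (P : Finset α) (x : α) : ℕ := (P.filter (· < x)).card

/-- The `j`-th gap of `P` on the circle, `j < |P|`: the points outside `P` with exactly `j` points
of `P` before them. Those before all and those after all points of `P` make up the
gap `j = 0`. -/
def gap (P : Finset α) (j : ℕ) : Finset α := {x | x ∉ P ∧ rankIn P x % P.card = j}

lemma mem_gap {P : Finset α} {j : ℕ} {x : α} :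
    x ∈ gap P j ↔ x ∉ P ∧ rankIn P x % P.card = j := by
  simp [gap]

lemma disjoint_gap (P : Finset α) : Pairwise fun i j => Disjoint (gap P i) (gap P j) := by
  intro i j hij
  rw [Finset.disjoint_left]
  intro x hi hj
  exact hij ((mem_gap.1 hi).2.symm.trans (mem_gap.1 hj).2)

/-- The matchings in which the chords with an endpoint in `P` form a union of chords, crossed by
no other chord, that has as many crossings as a connected diagram must have, and in which no
chord joins two different gaps of `P`. -/
def splitMatchings (P : Finset α) : Finset (α → α) :=
  (matchings Finset.univ).filter fun f => (∀ x ∈ P, f x ∈ P) ∧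
    P.card ≤ 2 * ((crossings (restrict P f)).card + 1) ∧
    ∀ x, x ∉ P → rankIn P (f x) % P.card = rankIn P x % P.card

lemma mem_splitMatchings {P : Finset α} {f : α → α} :
    f ∈ splitMatchings P ↔ f ∈ matchings Finset.univ ∧ (∀ x ∈ P, f x ∈ P) ∧
      P.card ≤ 2 * ((crossings (restrict P f)).card + 1) ∧
      ∀ x, x ∉ P → rankIn P (f x) % P.card = rankIn P x % P.card :=
  Finset.mem_filter

/-- There are `c ≥ k` crossings, so `q ^ c ≤ (2 * q) ^ k * (1 / 2) ^ c`. -/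
lemma sum_many_crossings_le {q : ℝ} (hq : 0 ≤ q) (hq1 : q ≤ 1 / 2) {P : Finset α} {k : ℕ}
    (hP : P.card = 2 * (k + 1)) :
    ∑ f ∈ (matchings P).filter (fun f => P.card ≤ 2 * ((crossings f).card + 1)),
      q ^ (crossings f).card ≤ (2 * q) ^ k * 8 ^ (k + 1) := by
  calc _ ≤ ∑ f ∈ (matchings P).filter (fun f => P.card ≤ 2 * ((crossings f).card + 1)),
        (2 * q) ^ k * (1 / 2) ^ (crossings f).card := by
        refine Finset.sum_le_sum fun f hf => ?_
        have hk : k ≤ (crossings f).card := by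
          have := (Finset.mem_filter.1 hf).2
          omega
        obtain ⟨d, hd⟩ := Nat.exists_eq_add_of_le hk
        rw [hd, pow_add, pow_add, mul_pow]
        have h1 : q ^ d ≤ (1 / 2) ^ d := pow_le_pow_left₀ hq hq1 d
        calc q ^ k * q ^ d ≤ q ^ k * (1 / 2) ^ d := by gcongr
          _ = 2 ^ k * q ^ k * ((1 / 2) ^ k * (1 / 2) ^ d) := by
            have : (2 : ℝ) ^ k * (1 / 2) ^ k = 1 := by rw [← mul_pow]; norm_num
            linear_combination (-(q ^ k * (1 / 2) ^ d)) * this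
    _ ≤ ∑ f ∈ matchings P, (2 * q) ^ k * (1 / 2) ^ (crossings f).card :=
        Finset.sum_le_sum_of_subset_of_nonneg (Finset.filter_subset _ _)
          fun _ _ _ => by positivity
    _ = (2 * q) ^ k * pathWeight (1 / 2) (2 * (k + 1)) 0 := by
        rw [← Finset.mul_sum, sum_matchings_pow_card_crossings, hP]
    _ ≤ _ := by
        gcongr
        exact pathWeight_half_le (k + 1)

lemma sum_splitMatchings_le {q : ℝ} (hq : 0 ≤ q) (hq1 : q ≤ 1 / 2) {P : Finset α} {k : ℕ}
    (hP : P.card = 2 * (k + 1)) :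
    ∑ f ∈ splitMatchings P, q ^ (crossings f).card ≤
      (2 * q) ^ k * 8 ^ (k + 1) * ∏ j ∈ Finset.range P.card, pathWeight q (gap P j).card 0 := by
  have hcompl : ∀ x, x ∈ (Finset.range P.card).biUnion (gap P) ↔ x ∉ P := by
    intro x
    rw [Finset.mem_biUnion]
    constructor
    · rintro ⟨j, -, hj⟩
      exact (mem_gap.1 hj).1
    · intro hx
      exact ⟨_, Finset.mem_range.2 (Nat.mod_lt _ (by omega)), mem_gap.2 ⟨hx, rfl⟩⟩
  have hdisj : Disjoint P ((Finset.range P.card).biUnion (gap P)) := by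
    rw [Finset.disjoint_left]
    exact fun x hx hx' => (hcompl x).1 hx' hx
  refine (sum_pow_card_crossings_le_mul hq (by linarith) hdisj
    (A := (matchings P).filter (fun f => P.card ≤ 2 * ((crossings f).card + 1)))
    (B := (matchings ((Finset.range P.card).biUnion (gap P))).filter
      (fun f => ∀ j ∈ Finset.range P.card, ∀ x ∈ gap P j, f x ∈ gap P j)) ?_ ?_ ?_).trans ?_
  · have : P ∪ (Finset.range P.card).biUnion (gap P) = Finset.univ := by
      ext x
      simp only [Finset.mem_union, hcompl, Finset.mem_univ, iff_true]
      exact em _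
    rw [this]
    exact Finset.filter_subset _ _
  · intro f hf
    obtain ⟨hf, h1, h2, -⟩ := Finset.mem_filter.1 hf
    exact Finset.mem_filter.2 ⟨restrict_mem_matchings hf (Finset.subset_univ _) h1, h2⟩
  · intro f hf
    obtain ⟨hf, h1, -, h3⟩ := Finset.mem_filter.1 hf
    have hout : ∀ x, x ∉ P → f x ∉ P := fun x hx h => hx (by
      have := h1 _ h
      rwa [(mem_matchings.1 hf).1] at this)
    refine Finset.mem_filter.2 ⟨restrict_mem_matchings hf (Finset.subset_univ _) ?_, ?_⟩
    · intro x hx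
      rw [hcompl] at hx ⊢
      exact hout x hx
    · intro j _ x hx
      have hxP := (mem_gap.1 hx).1
      rw [restrict_of_mem ((hcompl x).2 hxP)]
      exact mem_gap.2 ⟨hout x hxP, (h3 x hxP).trans (mem_gap.1 hx).2⟩
  · refine mul_le_mul (sum_many_crossings_le hq hq1 hP)
      (sum_pow_card_crossings_le_prod hq (by linarith) _ (disjoint_gap P) _)
      (Finset.sum_nonneg fun _ _ => by positivity) (by positivity)

end Splitting

section Gaps

variable {N : ℕ}

lemma rankIn_orderEmbOfFin {P : Finset (Fin N)} {s : ℕ} (h : P.card = s) (i : Fin s) :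
    rankIn P (P.orderEmbOfFin h i) = i := by
  have : P.filter (· < P.orderEmbOfFin h i) =
      (Finset.Iio i).map (P.orderEmbOfFin h).toEmbedding := by
    ext x
    simp only [Finset.mem_filter, Finset.mem_map, Finset.mem_Iio, RelEmbedding.coe_toEmbedding]
    constructor
    · rintro ⟨hx, hxi⟩
      have : x ∈ Set.range (P.orderEmbOfFin h) := by
        rw [Finset.range_orderEmbOfFin]; exact hx
      obtain ⟨j, rfl⟩ := this
      exact ⟨j, (P.orderEmbOfFin h).lt_iff_lt.1 hxi, rfl⟩
    · rintro ⟨j, hj, rfl⟩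
      exact ⟨Finset.orderEmbOfFin_mem _ _ _, (P.orderEmbOfFin h).lt_iff_lt.2 hj⟩
  rw [rankIn, this, Finset.card_map, Fin.card_Iio]

lemma rankIn_mono (P : Finset (Fin N)) : Monotone (rankIn P) := fun _ _ hxy =>
  Finset.card_le_card (Finset.monotone_filter_right _ fun _ _ hz => lt_of_lt_of_le hz hxy)

lemma rankIn_lt {P : Finset (Fin N)} {x y : Fin N} (hx : x ∈ P) (hxy : x < y) :
    rankIn P x < rankIn P y := by
  refine Finset.card_lt_card (Finset.ssubset_iff_of_subset ?_ |>.2 ⟨x, ?_, ?_⟩)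
  · exact Finset.monotone_filter_right _ fun _ _ hz => lt_trans hz hxy
  · simp [hx, hxy]
  · simp

lemma rankIn_le_card (P : Finset (Fin N)) (x : Fin N) : rankIn P x ≤ P.card :=
  Finset.card_filter_le _ _

lemma card_rankIn_eq_zero {P : Finset (Fin N)} {s : ℕ} (h : P.card = s + 1) :
    (Finset.univ.filter (fun x => rankIn P x = 0)).card = P.orderEmbOfFin h 0 + 1 := by
  have : Finset.univ.filter (fun x => rankIn P x = 0) = Finset.Iic (P.orderEmbOfFin h 0) := by
    ext x
    simp only [Finset.mem_filter, Finset.mem_univ, true_and, Finset.mem_Iic]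
    constructor
    · intro hx
      by_contra hlt
      have := rankIn_lt (Finset.orderEmbOfFin_mem P h 0) (not_le.1 hlt)
      omega
    · intro hx
      have := rankIn_mono P hx
      rw [rankIn_orderEmbOfFin] at this
      simpa using this
  rw [this, Fin.card_Iic]

/-- The gap `j + 1` consists of the points strictly between the `j`-th and the `(j + 1)`-st point
of `P`, both counted from `0`. -/
lemma card_gap {P : Finset (Fin N)} {s : ℕ} (h : P.card = s + 1) (j : Fin s) :
    (P.orderEmbOfFin h j.succ : ℕ) = P.orderEmbOfFin h j.castSucc + (gap P (j + 1)).card + 1 := by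
  have hlt : P.orderEmbOfFin h j.castSucc < P.orderEmbOfFin h j.succ :=
    (P.orderEmbOfFin h).lt_iff_lt.2 Fin.castSucc_lt_succ
  have : gap P (j + 1) = Finset.Ioo (P.orderEmbOfFin h j.castSucc) (P.orderEmbOfFin h j.succ) := by
    ext x
    rw [mem_gap, Finset.mem_Ioo]
    have hr1 := rankIn_orderEmbOfFin h j.castSucc
    have hr2 := rankIn_orderEmbOfFin h j.succ
    have hj := j.2
    simp only [Fin.val_castSucc, Fin.val_succ] at hr1 hr2
    constructor
    · rintro ⟨hxP, hx⟩
      have hle := rankIn_le_card P x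
      have hx' : rankIn P x = j + 1 := by
        rcases hle.lt_or_eq with h1 | h1
        · rwa [Nat.mod_eq_of_lt h1] at hx
        · rw [h1, Nat.mod_self] at hx
          omega
      constructor
      · by_contra hlt
        have := rankIn_mono P (not_lt.1 hlt)
        omega
      · rcases lt_trichotomy x (P.orderEmbOfFin h j.succ) with h1 | h1 | h1
        · exact h1
        · exact absurd (h1 ▸ Finset.orderEmbOfFin_mem P h j.succ) hxP
        · have := rankIn_lt (Finset.orderEmbOfFin_mem P h j.succ) h1
          omega
    · rintro ⟨h1, h2⟩
      have h3 := rankIn_lt (Finset.orderEmbOfFin_mem P h j.castSucc) h1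
      have h4 := rankIn_mono P h2.le
      refine ⟨fun hx => ?_, ?_⟩
      · have := rankIn_lt hx h2
        omega
      · rw [show rankIn P x = j + 1 by omega, Nat.mod_eq_of_lt (by omega)]
  rw [this, Fin.card_Ioo]
  have : (P.orderEmbOfFin h j.castSucc : ℕ) < P.orderEmbOfFin h j.succ := hlt
  omega

/-- A set of `s + 1` points is determined by the position of its first point and the sizes of the
`s` gaps between consecutive points. -/
lemma eq_of_card_gap_eq {P P' : Finset (Fin N)} {s : ℕ} (h : P.card = s + 1)
    (h' : P'.card = s + 1)
    (h0 : (Finset.univ.filter (fun x => rankIn P x = 0)).card =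
      (Finset.univ.filter (fun x => rankIn P' x = 0)).card)
    (hgap : ∀ j : Fin s, (gap P (j + 1)).card = (gap P' (j + 1)).card) : P = P' := by
  have he : ∀ j, P.orderEmbOfFin h j = P'.orderEmbOfFin h' j := by
    intro j
    induction j using Fin.induction with
    | zero =>
      rw [card_rankIn_eq_zero h, card_rankIn_eq_zero h'] at h0
      exact Fin.ext (by omega)
    | succ j ih =>
      have h1 := card_gap h j
      have h2 := card_gap h' j
      have h3 := hgap j
      rw [ih] at h1
      exact Fin.ext (by omega)
  rw [← Finset.coe_inj, ← Finset.range_orderEmbOfFin P h, ← Finset.range_orderEmbOfFin P' h']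
  congr 1
  exact funext he

/-- The gap sizes range over independent choices, except for the gap `0`, which is bounded by the
maximum of `w`. -/
lemma sum_prod_gap_le {w : ℕ → ℝ} (hw : ∀ u, 0 ≤ w u)
    (hsum : ∑ u ∈ Finset.range (N + 1), w u ≤ 2) {p : ℕ} (hp : 0 < p) :
    ∑ P ∈ Finset.powersetCard p (Finset.univ : Finset (Fin N)),
      ∏ j ∈ Finset.range p, w (gap P j).card ≤ (N + 1) * 2 ^ p := by
  obtain ⟨s, rfl⟩ : ∃ s, p = s + 1 := ⟨p - 1, by omega⟩
  have hcard : ∀ T : Finset (Fin N), T.card ∈ Finset.range (N + 1) := fun T => by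
    have := T.card_le_univ
    rw [Fintype.card_fin] at this
    exact Finset.mem_range.2 (by omega)
  have hw2 : ∀ T : Finset (Fin N), w T.card ≤ 2 := fun T =>
    (Finset.single_le_sum (fun u _ => hw u) (hcard T)).trans hsum
  set φ : Finset (Fin N) → ℕ × (Fin s → ℕ) := fun P =>
    ((Finset.univ.filter (fun x => rankIn P x = 0)).card, fun j => (gap P (j + 1)).card) with hφ
  have hinj : Set.InjOn φ (Finset.powersetCard (s + 1) (Finset.univ : Finset (Fin N))) := by
    intro P hP P' hP' he
    have hP := (Finset.mem_powersetCard.1 hP).2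
    have hP' := (Finset.mem_powersetCard.1 hP').2
    simp only [hφ, Prod.mk.injEq] at he
    exact eq_of_card_gap_eq hP hP' he.1 (fun j => congrFun he.2 j)
  calc _ ≤ ∑ P ∈ Finset.powersetCard (s + 1) (Finset.univ : Finset (Fin N)),
        (∏ j : Fin s, w ((φ P).2 j)) * 2 := by
        refine Finset.sum_le_sum fun P _ => ?_
        rw [Finset.prod_range_succ', ← Fin.prod_univ_eq_prod_range
          (fun j => w (gap P (j + 1)).card)]
        exact mul_le_mul_of_nonneg_left (hw2 _) (Finset.prod_nonneg fun _ _ => hw _)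
    _ = ∑ x ∈ (Finset.powersetCard (s + 1) (Finset.univ : Finset (Fin N))).image φ,
        (∏ j : Fin s, w (x.2 j)) * 2 := by rw [Finset.sum_image hinj]
    _ ≤ ∑ x ∈ Finset.range (N + 1) ×ˢ Fintype.piFinset fun _ : Fin s => Finset.range (N + 1),
        (∏ j : Fin s, w (x.2 j)) * 2 := by
        refine Finset.sum_le_sum_of_subset_of_nonneg ?_ fun x _ _ =>
          mul_nonneg (Finset.prod_nonneg fun _ _ => hw _) zero_le_two
        intro x hx
        obtain ⟨P, -, rfl⟩ := Finset.mem_image.1 hx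
        rw [Finset.mem_product, Fintype.mem_piFinset]
        exact ⟨hcard {x | rankIn P x = 0}, fun j => hcard (gap P (j + 1))⟩
    _ = (N + 1) * ((∑ u ∈ Finset.range (N + 1), w u) ^ s * 2) := by
        rw [Finset.sum_product]
        dsimp only
        rw [Finset.sum_const, Finset.card_range, nsmul_eq_mul, ← Finset.sum_mul,
          Finset.sum_prod_piFinset (Finset.range (N + 1)) (fun _ => w),
          Finset.prod_const, Finset.card_univ, Fintype.card_fin]
        push_cast
        ring
    _ ≤ (N + 1) * (2 ^ s * 2) := by
        have : 0 ≤ ∑ u ∈ Finset.range (N + 1), w u := Finset.sum_nonneg fun _ _ => hw _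
        gcongr
    _ = _ := by rw [pow_succ]

end Gaps

/-! ### The weight of matchings with a large part -/

section

variable {α : Type*} [LinearOrder α] [Fintype α]

open Classical in
/-- The matchings with a part of more than `K` chords that has the properties of a component. -/
noncomputable def badMatchings (α : Type*) [LinearOrder α] [Fintype α] (K : ℕ) : Finset (α → α) :=
  (matchings Finset.univ).filter fun f =>
    ∃ (k : ℕ) (P : Finset α), K ≤ k ∧ P.card = 2 * (k + 1) ∧ f ∈ splitMatchings P

lemma mem_badMatchings {K : ℕ} {f : α → α} :
    f ∈ badMatchings α K ↔ f ∈ matchings Finset.univ ∧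
      ∃ (k : ℕ) (P : Finset α), K ≤ k ∧ P.card = 2 * (k + 1) ∧ f ∈ splitMatchings P := by
  simp [badMatchings]

lemma card_add_sum_card_gap {P : Finset α} (hP : 0 < P.card) :
    P.card + ∑ j ∈ Finset.range P.card, (gap P j).card = Fintype.card α := by
  rw [← Finset.card_biUnion fun i _ j _ hij => disjoint_gap P hij,
    ← Finset.card_union_of_disjoint, ← Finset.card_univ]
  · congr 1
    ext x
    simp only [Finset.mem_union, Finset.mem_biUnion, Finset.mem_range, Finset.mem_univ, iff_true]
    by_cases hx : x ∈ P
    · exact Or.inl hx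
    · exact Or.inr ⟨_, Nat.mod_lt _ hP, mem_gap.2 ⟨hx, rfl⟩⟩
  · rw [Finset.disjoint_left]
    intro x hx hx'
    obtain ⟨j, -, hj⟩ := Finset.mem_biUnion.1 hx'
    exact (mem_gap.1 hj).1 hx

end

lemma sum_biUnion_le_sum_sum {ι κ : Type*} [DecidableEq ι] [DecidableEq κ] {f : κ → ℝ}
    (hf : ∀ x, 0 ≤ f x) (s : Finset ι) (t : ι → Finset κ) :
    ∑ x ∈ s.biUnion t, f x ≤ ∑ i ∈ s, ∑ x ∈ t i, f x := by
  induction s using Finset.induction_on with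
  | empty => simp
  | insert i s hi ih =>
    rw [Finset.biUnion_insert, Finset.sum_insert hi]
    have h1 := Finset.sum_union_inter (s₁ := t i) (s₂ := s.biUnion t) (f := f)
    have h2 : 0 ≤ ∑ x ∈ t i ∩ s.biUnion t, f x := Finset.sum_nonneg fun x _ => hf x
    linarith

/-- With weight `(1 - q) / 4` per chord, a part of `k + 1` chords and its gaps contribute a constant
times `(16 * q * (1 - q)) ^ k`, and `q * (1 - q)` is
increasing up to `q = 1 / 15`. -/
lemma sum_sum_splitMatchings_le (N : ℕ) {q : ℝ} (hq : 0 ≤ q) (hq1 : q ≤ 1 / 15) (k : ℕ) :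
    (∑ P ∈ Finset.powersetCard (2 * (k + 1)) (Finset.univ : Finset (Fin N)),
      ∑ f ∈ splitMatchings P, q ^ (crossings f).card) * (√(1 - q) / 2) ^ N ≤
      8 * (N + 1) * (224 / 225) ^ k := by
  set y := √(1 - q) / 2 with hy
  have hy0 : 0 ≤ y := by positivity
  have hy2 : y ^ 2 = (1 - q) / 4 := by
    rw [hy, div_pow, Real.sq_sqrt (by linarith)]; norm_num
  set w : ℕ → ℝ := fun u => pathWeight q u 0 * y ^ u with hw
  have hw0 : ∀ u, 0 ≤ w u := fun u => mul_nonneg (pathWeight_nonneg hq _ _) (pow_nonneg hy0 _)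
  have hsum := sum_prod_gap_le (N := N) hw0 (sum_pathWeight_mul_pow_le hq (by linarith) (N + 1))
    (show 0 < 2 * (k + 1) by omega)
  have hρ : 16 * (q * (1 - q)) ≤ 224 / 225 := by nlinarith
  have hρ0 : 0 ≤ 16 * (q * (1 - q)) := by nlinarith
  rw [Finset.sum_mul]
  calc _ ≤ ∑ P ∈ Finset.powersetCard (2 * (k + 1)) (Finset.univ : Finset (Fin N)),
        ((2 * q) ^ k * 8 ^ (k + 1) * y ^ (2 * (k + 1))) *
          ∏ j ∈ Finset.range (2 * (k + 1)), w (gap P j).card := by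
        refine Finset.sum_le_sum fun P hP => ?_
        have hP := (Finset.mem_powersetCard.1 hP).2
        have h1 := sum_splitMatchings_le hq (by linarith) hP
        have h2 := card_add_sum_card_gap (P := P) (by omega)
        rw [Fintype.card_fin] at h2
        rw [← hP]
        calc _ ≤ ((2 * q) ^ k * 8 ^ (k + 1) *
              ∏ j ∈ Finset.range P.card, pathWeight q (gap P j).card 0) * y ^ N := by gcongr
          _ = _ := by
            rw [show y ^ N = y ^ (P.card + ∑ j ∈ Finset.range P.card, (gap P j).card) by rw [h2],
              pow_add y P.card, ← Finset.prod_pow_eq_pow_sum, hw, Finset.prod_mul_distrib]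
            ring
    _ = ((2 * q) ^ k * 8 ^ (k + 1) * y ^ (2 * (k + 1))) *
          ∑ P ∈ Finset.powersetCard (2 * (k + 1)) (Finset.univ : Finset (Fin N)),
            ∏ j ∈ Finset.range (2 * (k + 1)), w (gap P j).card := by rw [Finset.mul_sum]
    _ ≤ ((2 * q) ^ k * 8 ^ (k + 1) * y ^ (2 * (k + 1))) * ((N + 1) * 2 ^ (2 * (k + 1))) := by
        gcongr
    _ = 8 * (1 - q) * (N + 1) * (16 * (q * (1 - q))) ^ k := by
        rw [pow_mul y, hy2, pow_mul 2, show (2 * q) ^ k * 8 ^ (k + 1) * ((1 - q) / 4) ^ (k + 1) *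
          (((N : ℝ) + 1) * (2 ^ 2) ^ (k + 1)) = (N + 1) * ((2 * q) ^ k *
          (8 * ((1 - q) / 4) * 2 ^ 2) ^ (k + 1)) by rw [mul_pow _ (2 ^ 2 : ℝ), mul_pow 8]; ring,
          pow_succ, ← mul_assoc ((2 * q) ^ k), ← mul_pow,
          show 2 * q * (8 * ((1 - q) / 4) * 2 ^ 2) = 16 * (q * (1 - q)) by ring]
        ring
    _ ≤ 8 * 1 * (N + 1) * (224 / 225) ^ k := by
        have : 0 ≤ 1 - q := by linarith
        gcongr
        linarith
    _ = _ := by ring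

lemma sum_badMatchings_le (n K : ℕ) {q : ℝ} (hq : 0 ≤ q) (hq1 : q ≤ 1 / 15) :
    (∑ f ∈ badMatchings (Fin (2 * n)) K, q ^ (crossings f).card) * ((1 - q) / 4) ^ n ≤
      1800 * (2 * n + 1) * (224 / 225) ^ K := by
  have hy2 : ((1 - q) / 4) ^ n = (√(1 - q) / 2) ^ (2 * n) := by
    rw [pow_mul, div_pow _ (2 : ℝ) 2, Real.sq_sqrt (by linarith)]; norm_num
  have hsub : badMatchings (Fin (2 * n)) K ⊆ (Finset.Ico K n).biUnion fun k =>
      (Finset.powersetCard (2 * (k + 1)) (Finset.univ : Finset (Fin (2 * n)))).biUnion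
        splitMatchings := by
    intro f hf
    obtain ⟨-, k, P, hk, hP, hfP⟩ := mem_badMatchings.1 hf
    have hcard := P.card_le_univ
    rw [Fintype.card_fin] at hcard
    exact Finset.mem_biUnion.2 ⟨k, Finset.mem_Ico.2 ⟨hk, by omega⟩, Finset.mem_biUnion.2
      ⟨P, Finset.mem_powersetCard.2 ⟨Finset.subset_univ _, hP⟩, hfP⟩⟩
  have hnn : ∀ f : Fin (2 * n) → Fin (2 * n), 0 ≤ q ^ (crossings f).card := fun f => by positivity
  calc _ ≤ (∑ k ∈ Finset.Ico K n,
        ∑ P ∈ Finset.powersetCard (2 * (k + 1)) (Finset.univ : Finset (Fin (2 * n))),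
          ∑ f ∈ splitMatchings P, q ^ (crossings f).card) * ((1 - q) / 4) ^ n := by
        have : 0 ≤ 1 - q := by linarith
        refine mul_le_mul_of_nonneg_right ?_ (by positivity)
        refine (Finset.sum_le_sum_of_subset_of_nonneg hsub fun _ _ _ => hnn _).trans ?_
        refine (sum_biUnion_le_sum_sum hnn _ _).trans ?_
        exact Finset.sum_le_sum fun k _ => sum_biUnion_le_sum_sum hnn _ _
    _ ≤ ∑ k ∈ Finset.Ico K n, 8 * (2 * n + 1) * (224 / 225 : ℝ) ^ k := by
        rw [Finset.sum_mul]
        refine Finset.sum_le_sum fun k _ => ?_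
        have := sum_sum_splitMatchings_le (2 * n) hq hq1 k
        rw [hy2]
        push_cast at this
        exact this
    _ ≤ 8 * (2 * n + 1) * ((224 / 225) ^ K / (1 - 224 / 225)) := by
        rw [← Finset.mul_sum]
        gcongr
        exact geom_sum_Ico_le_of_lt_one (by norm_num) (by norm_num)
    _ = _ := by ring

lemma card_filter_matchings_eq_coeff (n m : ℕ) :
    ((matchings (Finset.univ : Finset (Fin (2 * n)))).filter
      fun f => (crossings f).card = m).card =
      (pathWeight (Polynomial.X : Polynomial ℕ) (2 * n) 0).coeff m := by
  have h := sum_matchings_pow_card_crossings (Polynomial.X : Polynomial ℕ)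
    (Finset.univ : Finset (Fin (2 * n)))
  rw [Finset.card_univ, Fintype.card_fin] at h
  rw [← h, Polynomial.finsetSum_coeff, Finset.card_filter]
  refine Finset.sum_congr rfl fun f _ => ?_
  rw [Polynomial.coeff_X_pow]
  simp only [eq_comm]

/-- Among the matchings with `m` crossings, those with a large part are rare. -/
lemma card_filter_badMatchings_le {n m : ℕ} (hn : 98 ≤ n) (hm : 14 * m ≤ n) (K : ℕ) :
    (((badMatchings (Fin (2 * n)) K).filter fun f => (crossings f).card = m).card : ℝ) ≤
      345600 * (n : ℝ) ^ 5 * (224 / 225) ^ K *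
        ((matchings (Finset.univ : Finset (Fin (2 * n)))).filter
          fun f => (crossings f).card = m).card := by
  obtain ⟨q, hq⟩ : ∃ q : ℝ, q = m / (n + m) := ⟨_, rfl⟩
  have hn0 : (98 : ℝ) ≤ n := by exact_mod_cast hn
  have hm0 : 14 * (m : ℝ) ≤ n := by exact_mod_cast hm
  have hq0 : 0 ≤ q := by rw [hq]; positivity
  have hq1 : q ≤ 1 / 15 := by
    rw [hq, div_le_iff₀ (by positivity)]; linarith
  have h1 := one_le_mul_coeff_pathWeight hn hm hq
  have h2 := sum_badMatchings_le n K hq0 hq1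
  rw [card_filter_matchings_eq_coeff]
  set c := (pathWeight (Polynomial.X : Polynomial ℕ) (2 * n) 0).coeff m
  set B := (badMatchings (Fin (2 * n)) K).filter fun f => (crossings f).card = m with hB
  have h3 : (B.card : ℝ) * q ^ m ≤ ∑ f ∈ badMatchings (Fin (2 * n)) K, q ^ (crossings f).card := by
    rw [← nsmul_eq_mul, ← Finset.sum_const]
    calc ∑ _f ∈ B, q ^ m = ∑ f ∈ B, q ^ (crossings f).card :=
          Finset.sum_congr rfl fun f hf => by rw [(Finset.mem_filter.1 hf).2]
      _ ≤ _ := Finset.sum_le_sum_of_subset_of_nonneg (Finset.filter_subset _ _)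
          fun _ _ _ => by positivity
  have hR : 0 ≤ ((1 - q) / 4) ^ n := pow_nonneg (by linarith) _
  have hc : (0 : ℝ) ≤ c := Nat.cast_nonneg _
  calc (B.card : ℝ) = B.card * 1 := (mul_one _).symm
    _ ≤ B.card * (64 * (n : ℝ) ^ 4 * (c * q ^ m * ((1 - q) / 4) ^ n)) := by gcongr
    _ = 64 * (n : ℝ) ^ 4 * c * (B.card * q ^ m * ((1 - q) / 4) ^ n) := by ring
    _ ≤ 64 * (n : ℝ) ^ 4 * c * (1800 * (2 * n + 1) * (224 / 225) ^ K) := by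
        exact mul_le_mul_of_nonneg_left ((mul_le_mul_of_nonneg_right h3 hR).trans h2)
          (by positivity)
    _ ≤ 64 * (n : ℝ) ^ 4 * c * (1800 * (3 * n) * (224 / 225) ^ K) := by
        gcongr
        linarith
    _ = _ := by ring

/-! ### Components of a chord diagram -/

variable {n : ℕ}

lemma partner_mem_matchings (D : ChordDiagram n) : D.partner ∈ matchings Finset.univ :=
  mem_matchings.2 ⟨D.partner_partner, fun x => ⟨fun _ => Finset.mem_univ _, fun _ =>
    D.partner_ne x⟩⟩

lemma Chord.ext_left {D : ChordDiagram n} {c d : D.Chord} (h : c.left = d.left) : c = d :=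
  Subtype.ext h

lemma Chord.left_lt_right {D : ChordDiagram n} (c : D.Chord) : c.left < c.right := c.2

lemma Chord.right_injective {D : ChordDiagram n} {c d : D.Chord} (h : c.right = d.right) :
    c = d := by
  refine Chord.ext_left ?_
  have h' : D.partner c.1 = D.partner d.1 := h
  have := congrArg D.partner h'
  rwa [D.partner_partner, D.partner_partner] at this

/-- Recording an edge of the intersection graph by the first endpoints of its two chords
identifies edges with crossings. -/
lemma numCrossings_eq (D : ChordDiagram n) : D.numCrossings = (crossings D.partner).card := by
  have h1 : Function.Injective (Sym2.map (Chord.left (D := D))) :=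
    Sym2.map.injective fun _ _ h => Chord.ext_left h
  have h2 : Set.InjOn (fun p : Fin (2 * n) × Fin (2 * n) => s(p.1, p.2))
      (crossings D.partner : Set _) := by
    rintro ⟨a, b⟩ hp ⟨c, d⟩ hp' h
    have hp := (mem_crossings.1 hp).1
    have hp' := (mem_crossings.1 hp').1
    dsimp only at hp hp' h
    rw [Sym2.eq_iff] at h
    rcases h with ⟨rfl, rfl⟩ | ⟨rfl, rfl⟩
    · rfl
    · exact absurd hp hp'.not_gt
  rw [numCrossings, ← Set.ncard_image_of_injective _ h1, ← Set.ncard_coe_finset,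
    ← h2.ncard_image]
  congr 1
  ext e
  constructor
  · rintro ⟨e, he, rfl⟩
    induction e with
    | h c d =>
      rcases he with he | he
      · exact ⟨(c.left, d.left), mem_crossings.2 he, rfl⟩
      · exact ⟨(d.left, c.left), mem_crossings.2 he, Sym2.eq_swap⟩
  · rintro ⟨⟨a, b⟩, hp, rfl⟩
    have hp := mem_crossings.1 hp
    refine ⟨s(⟨a, hp.1.trans hp.2.1⟩, ⟨b, hp.2.1.trans hp.2.2⟩), ?_, rfl⟩
    exact Or.inl hp

/-- The chord with endpoint `x`. -/
def chordAt (D : ChordDiagram n) (x : Fin (2 * n)) : D.Chord :=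
  if h : x < D.partner x then ⟨x, h⟩ else
    ⟨D.partner x, by
      rw [D.partner_partner]
      exact lt_of_le_of_ne (not_lt.1 h) (D.partner_ne x)⟩

lemma chordAt_of_lt {D : ChordDiagram n} {x : Fin (2 * n)} (h : x < D.partner x) :
    D.chordAt x = ⟨x, h⟩ := dif_pos h

lemma chordAt_of_gt {D : ChordDiagram n} {x : Fin (2 * n)} (h : D.partner x < x) :
    D.chordAt x = ⟨D.partner x, by rwa [D.partner_partner]⟩ := dif_neg h.not_gt

lemma chordAt_left {D : ChordDiagram n} (c : D.Chord) : D.chordAt c.left = c := dif_pos c.2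

lemma chordAt_partner (D : ChordDiagram n) (x : Fin (2 * n)) :
    D.chordAt (D.partner x) = D.chordAt x := by
  rcases lt_or_gt_of_ne (D.partner_ne x) with h | h
  · rw [chordAt_of_gt h, chordAt_of_lt (by rwa [D.partner_partner])]
  · rw [chordAt_of_lt h, chordAt_of_gt (by rwa [D.partner_partner])]
    exact Subtype.ext (D.partner_partner x)

lemma eq_left_or_eq_right (D : ChordDiagram n) (x : Fin (2 * n)) :
    x = (D.chordAt x).left ∨ x = (D.chordAt x).right := by
  rcases lt_or_gt_of_ne (D.partner_ne x) with h | h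
  · right
    rw [chordAt_of_gt h]
    exact (D.partner_partner x).symm
  · left
    rw [chordAt_of_lt h]
    rfl

open Classical in
/-- The endpoints of the chords of a component. -/
noncomputable def componentPoints (D : ChordDiagram n)
    (K : D.intersectionGraph.ConnectedComponent) : Finset (Fin (2 * n)) :=
  {x | D.chordAt x ∈ K.supp}

variable {D : ChordDiagram n} {K : D.intersectionGraph.ConnectedComponent}

lemma mem_componentPoints {x : Fin (2 * n)} :
    x ∈ D.componentPoints K ↔ D.chordAt x ∈ K.supp := by
  simp [componentPoints]

lemma partner_mem_componentPoints {x : Fin (2 * n)} :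
    D.partner x ∈ D.componentPoints K ↔ x ∈ D.componentPoints K := by
  rw [mem_componentPoints, mem_componentPoints, chordAt_partner]

lemma left_mem_componentPoints {c : D.Chord} :
    c.left ∈ D.componentPoints K ↔ c ∈ K.supp := by
  rw [mem_componentPoints, chordAt_left]

lemma card_componentPoints : (D.componentPoints K).card = 2 * K.supp.ncard := by
  have h1 : ((D.componentPoints K).filter (fun x => x < D.partner x)).card = K.supp.ncard := by
    rw [← Set.ncard_image_of_injective K.supp
      (show Function.Injective (Chord.left (D := D)) from fun _ _ h => Chord.ext_left h),
      ← Set.ncard_coe_finset]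
    congr 1
    ext x
    simp only [Finset.coe_filter, Set.mem_ofPred_eq, Set.mem_image]
    constructor
    · rintro ⟨hx, hlt⟩
      exact ⟨⟨x, hlt⟩, left_mem_componentPoints.1 hx, rfl⟩
    · rintro ⟨c, hc, rfl⟩
      exact ⟨left_mem_componentPoints.2 hc, c.2⟩
  have h2 : ((D.componentPoints K).filter (fun x => ¬ x < D.partner x)).card =
      ((D.componentPoints K).filter (fun x => x < D.partner x)).card := by
    refine Finset.card_nbij' D.partner D.partner ?_ ?_ (fun x _ => D.partner_partner x)
      (fun x _ => D.partner_partner x)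
    · intro x hx
      simp only [Finset.coe_filter, Set.mem_ofPred_eq] at hx ⊢
      rw [partner_mem_componentPoints, D.partner_partner]
      exact ⟨hx.1, lt_of_le_of_ne (not_lt.1 hx.2) (D.partner_ne x)⟩
    · intro x hx
      simp only [Finset.coe_filter, Set.mem_ofPred_eq] at hx ⊢
      rw [partner_mem_componentPoints, D.partner_partner]
      exact ⟨hx.1, hx.2.not_gt⟩
  rw [← Finset.card_filter_add_card_filter_not (s := D.componentPoints K)
    (fun x => x < D.partner x), h2, h1]
  ring

/-- A component contains a spanning tree of its intersection graph. -/
lemma ncard_supp_le_card_crossings_add_one :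
    K.supp.ncard ≤ (crossings (restrict (D.componentPoints K) D.partner)).card + 1 := by
  have h := K.connected_toSimpleGraph.card_vert_le_card_edgeSet_add_one
  have hV : Nat.card K = K.supp.ncard := rfl
  rw [hV] at h
  refine h.trans (Nat.add_le_add_right ?_ 1)
  have hinj : Function.Injective (Sym2.map (fun c : K => c.1.left)) :=
    Sym2.map.injective fun _ _ h => Subtype.ext (Chord.ext_left h)
  have h1 : Nat.card K.toSimpleGraph.edgeSet = K.toSimpleGraph.edgeSet.ncard := rfl
  rw [h1, ← Set.ncard_image_of_injective _ hinj]
  refine le_trans ?_ (Finset.card_image_le (f := fun p : Fin (2 * n) × Fin (2 * n) => s(p.1, p.2)))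
  rw [← Set.ncard_coe_finset]
  refine Set.ncard_le_ncard ?_ (Finset.finite_toSet _)
  rintro _ ⟨e, he, rfl⟩
  rw [Finset.coe_image]
  have key : ∀ c d : K, c.1.left < d.1.left ∧ d.1.left < c.1.right ∧ c.1.right < d.1.right →
      (c.1.left, d.1.left) ∈ crossings (restrict (D.componentPoints K) D.partner) := by
    intro c d hcd
    rw [mem_crossings, restrict_of_mem (left_mem_componentPoints.2 c.2),
      restrict_of_mem (left_mem_componentPoints.2 d.2)]
    exact hcd
  induction e with
  | h c d =>
    have he : Crosses c.1 d.1 := he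
    rcases he with he | he
    · exact ⟨(c.1.left, d.1.left), key c d he, rfl⟩
    · exact ⟨(d.1.left, c.1.left), key d c he, Sym2.eq_swap⟩

/-- A chord outside a component does not separate the chords of the component. -/
lemma inside_of_inside {x c d : D.Chord} (hx : x ∉ K.supp) (hc : c ∈ K.supp) (hd : d ∈ K.supp)
    (hin : x.left < c.left ∧ c.right < x.right) : x.left < d.left ∧ d.right < x.right := by
  have hreach : D.intersectionGraph.Reachable c d :=
    SimpleGraph.ConnectedComponent.exact ((K.mem_supp_iff c).1 hc |>.trans
      ((K.mem_supp_iff d).1 hd).symm)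
  obtain ⟨p⟩ := hreach
  induction p with
  | nil => exact hin
  | @cons u v w hadj p ih =>
    have hv : v ∈ K.supp := by
      rw [SimpleGraph.ConnectedComponent.mem_supp_iff] at hc ⊢
      rw [← hc]
      exact SimpleGraph.ConnectedComponent.sound hadj.reachable.symm
    refine ih hv hd ?_
    have hnc : ¬ Crosses x v := fun h => hx (by
      rw [SimpleGraph.ConnectedComponent.mem_supp_iff] at hv ⊢
      rw [← hv]
      exact SimpleGraph.ConnectedComponent.sound
        (SimpleGraph.Adj.reachable (G := D.intersectionGraph) h))
    have hne : x ≠ v := by rintro rfl; exact hx hv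
    have hl : x.left ≠ v.left := fun h => hne (Chord.ext_left h)
    have hr : x.right ≠ v.right := fun h => hne (Chord.right_injective h)
    have hadj : Crosses u v := hadj
    have h1 := u.left_lt_right
    have h2 := v.left_lt_right
    unfold Crosses at hnc hadj
    omega

/-- The endpoints of a chord outside a component lie in the same gap of its point set. -/
lemma rankIn_partner_mod {x : Fin (2 * n)} (hx : x ∉ D.componentPoints K) :
    rankIn (D.componentPoints K) (D.partner x) % (D.componentPoints K).card =
      rankIn (D.componentPoints K) x % (D.componentPoints K).card := by
  set P := D.componentPoints K with hP
  have key : ∀ y : D.Chord, y ∉ K.supp →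
      rankIn P y.right % P.card = rankIn P y.left % P.card := by
    intro y hy
    have hylr := y.left_lt_right
    have hsplit : rankIn P y.right = rankIn P y.left +
        (P.filter fun z => y.left ≤ z ∧ z < y.right).card := by
      rw [rankIn, rankIn, ← Finset.card_union_of_disjoint]
      · congr 1
        ext z
        simp only [Finset.mem_union, Finset.mem_filter]
        constructor
        · rintro ⟨h1, h2⟩
          by_cases h : z < y.left
          · exact Or.inl ⟨h1, h⟩
          · exact Or.inr ⟨h1, not_lt.1 h, h2⟩
        · rintro (⟨h1, h2⟩ | ⟨h1, h2, h3⟩)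
          · exact ⟨h1, h2.trans hylr⟩
          · exact ⟨h1, h3⟩
      · rw [Finset.disjoint_left]
        intro z h1 h2
        exact absurd (Finset.mem_filter.1 h1).2 (Finset.mem_filter.1 h2).2.1.not_gt
    have hmem : ∀ z ∈ P, (y.left ≤ z ∧ z < y.right) ↔
        (y.left < (D.chordAt z).left ∧ (D.chordAt z).right < y.right) := by
      intro z hz
      have hc := mem_componentPoints.1 hz
      have hz' := D.eq_left_or_eq_right z
      have hlr := (D.chordAt z).left_lt_right
      generalize D.chordAt z = c at hc hz' hlr
      have hnc : ¬ Crosses y c := fun h => hy (by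
        rw [SimpleGraph.ConnectedComponent.mem_supp_iff] at hc ⊢
        rw [← hc]
        exact SimpleGraph.ConnectedComponent.sound
          (SimpleGraph.Adj.reachable (G := D.intersectionGraph) h))
      have hne : y ≠ c := by rintro rfl; exact hy hc
      have hl : y.left ≠ c.left := fun h => hne (Chord.ext_left h)
      have hr : y.right ≠ c.right := fun h => hne (Chord.right_injective h)
      have hlr' : y.left ≠ c.right := fun h => hne (by
        have h1 := D.chordAt_partner c.left
        rw [chordAt_left] at h1
        rw [← h1, ← chordAt_left y, h]
        rfl)
      unfold Crosses at hnc
      omega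
    rcases (P.filter fun z => y.left ≤ z ∧ z < y.right).eq_empty_or_nonempty with h | ⟨z, hz⟩
    · rw [hsplit, h, Finset.card_empty, add_zero]
    · obtain ⟨hzP, hz⟩ := Finset.mem_filter.1 hz
      rw [hsplit, Finset.filter_true_of_mem, Nat.add_mod_right]
      intro w hw
      exact (hmem w hw).2 (inside_of_inside hy (mem_componentPoints.1 hzP)
        (mem_componentPoints.1 hw) ((hmem z hzP).1 hz))
  rw [hP, mem_componentPoints] at hx
  have h := key _ hx
  rcases D.eq_left_or_eq_right x with h1 | h1
  · have h2 : (D.chordAt x).right = D.partner x := by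
      conv_rhs => rw [h1]
      rfl
    rwa [← h1, h2] at h
  · have h2 : (D.chordAt x).left = D.partner x := by
      conv_rhs => rw [h1]
      exact (D.partner_partner _).symm
    rw [← h1, h2] at h
    exact h.symm

lemma partner_mem_badMatchings {B : ℕ} (h : B < D.largestComponentSize) :
    D.partner ∈ badMatchings (Fin (2 * n)) B := by
  obtain ⟨K, hK⟩ := exists_lt_of_lt_ciSup' h
  obtain ⟨k, hk⟩ : ∃ k, K.supp.ncard = k + 1 := ⟨K.supp.ncard - 1, by omega⟩
  refine mem_badMatchings.2 ⟨D.partner_mem_matchings, k, D.componentPoints K, by omega, ?_, ?_⟩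
  · rw [card_componentPoints, hk]
  · refine mem_splitMatchings.2 ⟨D.partner_mem_matchings, ?_, ?_, ?_⟩
    · exact fun x hx => partner_mem_componentPoints.2 hx
    · rw [card_componentPoints]
      exact Nat.mul_le_mul_left 2 ncard_supp_le_card_crossings_add_one
    · exact fun x hx => rankIn_partner_mod hx

/-! ### The random chord diagram -/

lemma partner_injective (n : ℕ) : Function.Injective (ChordDiagram.partner (n := n)) :=
  fun _ _ h => ChordDiagram.ext h

lemma ncard_setOf_numCrossings_eq (n m : ℕ) :
    {D : ChordDiagram n | D.numCrossings = m}.ncard =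
      ((matchings (Finset.univ : Finset (Fin (2 * n)))).filter
        fun f => (crossings f).card = m).card := by
  rw [← Set.ncard_image_of_injective _ (partner_injective n), ← Set.ncard_coe_finset]
  congr 1
  ext f
  rw [Finset.mem_coe, Finset.mem_filter]
  constructor
  · rintro ⟨D, hD, rfl⟩
    exact ⟨D.partner_mem_matchings, by rw [← numCrossings_eq]; exact hD⟩
  · rintro ⟨hf, hc⟩
    have hf := mem_matchings.1 hf
    exact ⟨⟨f, hf.1, fun a => (hf.2 a).2 (Finset.mem_univ a)⟩, (numCrossings_eq _).trans hc, rfl⟩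

lemma randomDiagram_apply (n m : ℕ) (s : Set (ChordDiagram n)) :
    randomDiagram n m s = (({D : ChordDiagram n | D.numCrossings = m} ∩ s).ncard : ENNReal) /
      ({D : ChordDiagram n | D.numCrossings = m}.ncard : ENNReal) := by
  have hcount : ∀ t : Set (ChordDiagram n), MeasureTheory.Measure.count t = (t.ncard : ENNReal) :=
    fun t => by
      rw [MeasureTheory.Measure.count_apply_finite t t.toFinite,
        Set.ncard_eq_toFinset_card t t.toFinite]
  rw [randomDiagram, uniformOn, cond_apply (Set.toFinite _).measurableSet, hcount, hcount, mul_comm,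
    div_eq_mul_inv]

lemma randomDiagram_setOf_lt_le {n m : ℕ} (hn : 98 ≤ n) (hm : 14 * m ≤ n) (K : ℕ) :
    randomDiagram n m {D | K < D.largestComponentSize} ≤
      ENNReal.ofReal (345600 * (n : ℝ) ^ 5 * (224 / 225) ^ K) := by
  rw [randomDiagram_apply]
  refine ENNReal.div_le_of_le_mul ?_
  have h1 : (({D : ChordDiagram n | D.numCrossings = m} ∩
      {D | K < D.largestComponentSize}).ncard) ≤
      ((badMatchings (Fin (2 * n)) K).filter fun f => (crossings f).card = m).card := by
    rw [← Set.ncard_image_of_injective _ (partner_injective n), ← Set.ncard_coe_finset]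
    refine Set.ncard_le_ncard ?_ (Finset.finite_toSet _)
    rintro _ ⟨D, ⟨hD, hK⟩, rfl⟩
    rw [Finset.mem_coe, Finset.mem_filter]
    exact ⟨partner_mem_badMatchings hK, by rw [← numCrossings_eq]; exact hD⟩
  have h2 := (Nat.cast_le (α := ℝ).2 h1).trans (card_filter_badMatchings_le hn hm K)
  rw [← ncard_setOf_numCrossings_eq] at h2
  rw [← ENNReal.ofReal_natCast, ← ENNReal.ofReal_natCast, ← ENNReal.ofReal_mul (by positivity)]
  exact ENNReal.ofReal_le_ofReal h2

lemma isProbabilityMeasure_randomDiagram {n m : ℕ} (hn : 98 ≤ n) (hm : 14 * m ≤ n) :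
    MeasureTheory.IsProbabilityMeasure (randomDiagram n m) := by
  refine isProbabilityMeasure_uniformOn (Set.toFinite _) ?_
  rw [← Set.ncard_pos, ncard_setOf_numCrossings_eq, card_filter_matchings_eq_coeff]
  by_contra h
  have h1 := one_le_mul_coeff_pathWeight hn hm rfl
  rw [Nat.eq_zero_of_not_pos h] at h1
  norm_num at h1

lemma tendsto_pow_mul_pow_floor {A : ℝ} (hA : 5 / Real.log (225 / 224) < A) :
    Tendsto (fun n : ℕ => 345600 * (n : ℝ) ^ 5 * (224 / 225) ^ ⌊A * Real.log n⌋₊) atTop (𝓝 0) := by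
  have hc : 0 < Real.log (225 / 224) := Real.log_pos (by norm_num)
  have hb : 0 < A * Real.log (225 / 224) - 5 := by
    rw [div_lt_iff₀ hc] at hA
    linarith
  have hlim : Tendsto (fun n : ℕ => 345600 * (225 / 224) *
      (n : ℝ) ^ (-(A * Real.log (225 / 224) - 5))) atTop (𝓝 0) := by
    have := ((tendsto_rpow_neg_atTop hb).comp tendsto_natCast_atTop_atTop).const_mul
      (345600 * (225 / 224) : ℝ)
    rwa [mul_zero] at this
  refine squeeze_zero' (Eventually.of_forall fun n => by positivity) ?_ hlim
  filter_upwards [eventually_gt_atTop 0] with n hn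
  have hn0 : (0 : ℝ) < n := by exact_mod_cast hn
  have h1 : (224 / 225 : ℝ) ^ ⌊A * Real.log n⌋₊ ≤
      225 / 224 * (n : ℝ) ^ (-(A * Real.log (225 / 224))) := by
    rw [← Real.rpow_natCast]
    calc (224 / 225 : ℝ) ^ (⌊A * Real.log n⌋₊ : ℝ) ≤ (224 / 225 : ℝ) ^ (A * Real.log n - 1) :=
          Real.rpow_le_rpow_of_exponent_ge (by norm_num) (by norm_num) (Nat.sub_one_lt_floor _).le
      _ = _ := by
          rw [Real.rpow_sub (by norm_num), Real.rpow_one, Real.rpow_def_of_pos (by norm_num),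
            Real.rpow_def_of_pos hn0,
            show (224 / 225 : ℝ) = (225 / 224)⁻¹ by norm_num, Real.log_inv, div_inv_eq_mul]
          ring_nf
  calc _ ≤ 345600 * (n : ℝ) ^ 5 * (225 / 224 * (n : ℝ) ^ (-(A * Real.log (225 / 224)))) := by
        gcongr
    _ = _ := by
        rw [show -(A * Real.log (225 / 224) - 5) = (5 : ℕ) + -(A * Real.log (225 / 224)) by
          push_cast; ring, Real.rpow_add hn0, Real.rpow_natCast]
        ring

end ChordDiagram

theorem mainTheorem3 (A : ℝ) (hA : 5 / Real.log (225 / 224) < A)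
    (m : ℕ → ℕ) (hm : ∀ n : ℕ, (m n : ℝ) ≤ (n : ℝ) / 14) :
    Tendsto
      (fun n : ℕ => ChordDiagram.randomDiagram n (m n)
        {D : ChordDiagram n | (D.largestComponentSize : ℝ) ≤ A * Real.log n})
      atTop (𝓝 1) := by
  have hm' : ∀ n, 14 * m n ≤ n := fun n => by
    have := hm n
    have h : 14 * (m n : ℝ) ≤ n := by linarith
    exact_mod_cast h
  have hlim : Tendsto (fun n : ℕ => 1 - ENNReal.ofReal
      (345600 * (n : ℝ) ^ 5 * (224 / 225) ^ ⌊A * Real.log n⌋₊)) atTop (𝓝 1) := by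
    have h := ENNReal.tendsto_ofReal (ChordDiagram.tendsto_pow_mul_pow_floor hA)
    rw [ENNReal.ofReal_zero] at h
    have h1 := ENNReal.Tendsto.sub (tendsto_const_nhds (x := (1 : ENNReal))) h
      (Or.inl ENNReal.one_ne_top)
    rwa [tsub_zero] at h1
  refine tendsto_of_tendsto_of_tendsto_of_le_of_le' hlim tendsto_const_nhds ?_ ?_
  · filter_upwards [eventually_ge_atTop 98] with n hn
    have := ChordDiagram.isProbabilityMeasure_randomDiagram hn (hm' n)
    have hbad : {D : ChordDiagram n | (D.largestComponentSize : ℝ) ≤ A * Real.log n}ᶜ ⊆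
        {D | ⌊A * Real.log n⌋₊ < D.largestComponentSize} := by
      intro D hD
      have hD : ¬ (D.largestComponentSize : ℝ) ≤ A * Real.log n := hD
      by_contra h
      refine hD ((Nat.cast_le.2 (not_lt.1 h)).trans (Nat.floor_le ?_))
      have hc : 0 < Real.log (225 / 224) := Real.log_pos (by norm_num)
      have hA0 : 0 < A := lt_trans (by positivity) hA
      have : 0 ≤ Real.log n := Real.log_natCast_nonneg n
      positivity
    have h1 := (MeasureTheory.measure_mono hbad).trans
      (ChordDiagram.randomDiagram_setOf_lt_le hn (hm' n) ⌊A * Real.log n⌋₊)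
    rw [← compl_compl {D : ChordDiagram n | (D.largestComponentSize : ℝ) ≤ A * Real.log n},
      MeasureTheory.prob_compl_eq_one_sub (Set.toFinite _).measurableSet]
    exact tsub_le_tsub_left h1 1
  · filter_upwards [eventually_ge_atTop 98] with n hn
    have := ChordDiagram.isProbabilityMeasure_randomDiagram hn (hm' n)
    exact MeasureTheory.prob_le_one
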